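/- Let $M$ be a closed smooth manifold of dimension $2m+3$ ($m\ge 0$) and let $\alpha$ be a contact form on $M$, i.e. a smooth 1-form such that $\alpha\wedge(d\alpha)^{m+1}$ vanishes nowhere; orient $M$ by this form, and let $R$ be the Reeb vector field of $\alpha$ ($\alpha(R)=1$, $d\alpha(R,\cdot)=0$). Let $(B,\pi)$ be an open book decomposition of $M$: $B\subset M$ is a closed embedded submanifold of codimension $2$, $\pi:M\setminus B\to S^1$ is a submersion, and there is a diffeomorphism $\phi:B\times B^2(\delta)\to U$ onto a neighbourhood $U$ of $B$ with $\phi(p,0)=p$ and $(\pi\circ\phi)(p,r,\theta)=\theta$ in polar coordinates $(r,\theta)$ on the disc $B^2(\delta)$. The page over $t\in S^1$ is $P_t=\overline{\pi^{-1}(t)}$. Orient $B$ so that $\phi$ preserves orientations, the disc being oriented by $r\,dr\wedge d\theta$ (this is the orientation of $B$ as boundary of the pages). Assume that $\alpha$ supports $(B,\pi)$, that is: $\alpha_B=\alpha|_{B}$ is a contact form on $B$ with $\alpha_B\wedge(d\alpha_B)^m>0$ for the above orientation of $B$; $d\pi(R)>0$ on $M\setminus B$; and $R$ is tangent to $B$.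 Then for every $t\in S^1$ the binding $B$ is a convex boundary of the page $P_t$ with respect to the Liouville form $\alpha|_{P_t}$. Precisely: 1. $P_t$ is a smoothly embedded hypersurface with boundary in $M$, and $\partial P_t=B$. 2. $d\alpha$ restricts to a symplectic form on the interior $P_t\setminus B$, so that the Liouville vector field $X$ of $\alpha|_{P_t}$ is defined there by $\alpha|_{P_t}=i_X\,(d\alpha|_{P_t})$. 3. $X$ is transverse to $B$ and points outwards, in the following sense (the restriction $d\alpha|_{P_t}$ degenerates along $B$, because $R$ is tangent to $B$, and $X$ has no finite limit there): there are a smooth function $u$ and a smooth vector field $Y$, both defined on an open neighbourhood $U'$ of $B$ in $M$, such that $u>0$ and $Y=uX$ on $(P_t\setminus B)\cap U'$, and such that at every point of $B$ the vector $Y$ is tangent to $P_t$, transverse to $B$, and points out of $P_t$. -/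

import Mathlib

open Set Filter Topology Manifold
open scoped ContDiff

noncomputable section

/-! ### One-forms, the exterior derivative, contact forms -/

/-- A (not necessarily smooth) 1-form on a `d`-dimensional manifold without boundary. -/
abbrev OneForm (d : ℕ) (M : Type*) [TopologicalSpace M]
    [ChartedSpace (EuclideanSpace ℝ (Fin d)) M] : Type _ :=
  ∀ x : M, TangentSpace (𝓡 d) x →L[ℝ] ℝ

namespace OneForm

variable {d k : ℕ} {M : Type*} [TopologicalSpace M] [ChartedSpace (EuclideanSpace ℝ (Fin d)) M]
  {B : Type*} [TopologicalSpace B] [ChartedSpace (EuclideanSpace ℝ (Fin k)) B]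

/-- Smoothness of a 1-form, as a section of the cotangent bundle. -/
def IsSmooth [IsManifold (𝓡 d) ∞ M] (α : OneForm d M) : Prop :=
  ContMDiff (𝓡 d) ((𝓡 d).prod 𝓘(ℝ, EuclideanSpace ℝ (Fin d) →L[ℝ] ℝ)) ∞
    (fun x : M => Bundle.TotalSpace.mk' (EuclideanSpace ℝ (Fin d) →L[ℝ] ℝ)
      (E := fun x : M => TangentSpace (𝓡 d) x →L[ℝ] Bundle.Trivial M ℝ x) x (α x))

/-- The local expression of `α` in the preferred chart at `x`, i.e. its pullback under the inverse
of that chart, as a differential form of degree one on the model space. -/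
def localRep (α : OneForm d M) (x : M) (y : EuclideanSpace ℝ (Fin d)) :
    EuclideanSpace ℝ (Fin d) [⋀^Fin 1]→L[ℝ] ℝ :=
  ContinuousAlternatingMap.ofSubsingleton ℝ (EuclideanSpace ℝ (Fin d)) ℝ 0
    ((α ((chartAt (EuclideanSpace ℝ (Fin d)) x).symm y)).comp
      (mfderiv (𝓡 d) (𝓡 d) (chartAt (EuclideanSpace ℝ (Fin d)) x).symm y))

/-- The exterior derivative `dα`, evaluated at the point `x` on two tangent vectors:
it is computed in the preferred chart at `x`. -/
def extD (α : OneForm d M) (x : M) (v w : TangentSpace (𝓡 d) x) : ℝ :=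
  extDeriv (α.localRep x) (chartAt (EuclideanSpace ℝ (Fin d)) x x)
    ![mfderiv (𝓡 d) (𝓡 d) (chartAt (EuclideanSpace ℝ (Fin d)) x) x v,
      mfderiv (𝓡 d) (𝓡 d) (chartAt (EuclideanSpace ℝ (Fin d)) x) x w]

/-- The pullback `f^* α` of a 1-form. -/
def pullback (f : B → M) (α : OneForm d M) : OneForm k B :=
  fun p => (α (f p)).comp (mfderiv (𝓡 k) (𝓡 d) f p)

/-- The value of `α ∧ (dα)^n` at the point `x` on `2n+1` tangent vectors:
the alternating sum defining the wedge product of one 1-form and `n` 2-forms. -/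
def wedgePow (n : ℕ) (α : OneForm d M) (x : M) (v : Fin (2 * n + 1) → TangentSpace (𝓡 d) x) : ℝ :=
  (1 / 2 ^ n : ℝ) * ∑ σ : Equiv.Perm (Fin (2 * n + 1)),
    ((Equiv.Perm.sign σ : ℤ) : ℝ) * (α x (v (σ 0)) *
      ∏ i : Fin n, α.extD x (v (σ ⟨2 * i + 1, by omega⟩)) (v (σ ⟨2 * i + 2, by omega⟩)))

/-- `α` is a contact form on the `(2n+1)`-dimensional manifold `M`: it is smooth and the top-degree
form `α ∧ (dα)^n` vanishes nowhere. (It is then positive for exactly one orientation of `M`, which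
is the orientation of `M` as a contact manifold.) -/
structure IsContact [IsManifold (𝓡 d) ∞ M] (n : ℕ) (α : OneForm d M) : Prop where
  dim_eq : d = 2 * n + 1
  smooth : α.IsSmooth
  ne_zero : ∀ x : M, ∃ v : Fin (2 * n + 1) → TangentSpace (𝓡 d) x, α.wedgePow n x v ≠ 0

/-- `R` is the Reeb vector field of `α`. -/
def IsReeb (α : OneForm d M) (R : ∀ x : M, TangentSpace (𝓡 d) x) : Prop :=
  ∀ x : M, α x (R x) = 1 ∧ ∀ w : TangentSpace (𝓡 d) x, α.extD x (R x) w = 0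

end OneForm

/-! ### Open books -/

section OpenBook

variable {d k : ℕ} {M : Type*} [TopologicalSpace M] [ChartedSpace (EuclideanSpace ℝ (Fin d)) M]
  {B : Type*} [TopologicalSpace B] [ChartedSpace (EuclideanSpace ℝ (Fin k)) B]

variable (d k) in
/-- `φ : B × B²(δ) → U` is a trivializing diffeomorphism onto a (tubular) neighbourhood `U` of the
submanifold `ι : B → M`, with `φ(p, 0) = p`, for which `π ∘ φ` is the angular coordinate on the
disc. The disc `B²(δ)` is the disc of radius `δ` in `ℂ`. -/
structure IsBindingTrivialization (ι : B → M) (π : M → Circle) (δ : ℝ)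
    (φ : OpenPartialHomeomorph (B × ℂ) M) : Prop where
  pos : 0 < δ
  source_eq : φ.source = univ ×ˢ Metric.ball (0 : ℂ) δ
  smooth : ContMDiffOn ((𝓡 k).prod 𝓘(ℝ, ℂ)) (𝓡 d) ∞ φ φ.source
  smooth_symm : ContMDiffOn (𝓡 d) ((𝓡 k).prod 𝓘(ℝ, ℂ)) ∞ φ.symm φ.target
  zero_section : ∀ p : B, φ (p, 0) = ι p
  angular : ∀ (p : B) (z : ℂ), z ∈ Metric.ball (0 : ℂ) δ → z ≠ 0 →
    (π (φ (p, z)) : ℂ) = z / (‖z‖ : ℂ)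

variable (d k) in
/-- `(B, π)` is an open book decomposition of the closed manifold `M`. The binding is given as a
manifold `B` with an embedding `ι` onto a closed subset of `M`; only the values of `π` on the
complement of the binding matter. -/
structure IsOpenBook (ι : B → M) (π : M → Circle) : Prop where
  codim_two : d = k + 2
  embedding : IsSmoothEmbedding (𝓡 k) (𝓡 d) ∞ ι
  isClosed_range : IsClosed (range ι)
  smooth : ContMDiffOn (𝓡 d) (𝓡 1) ∞ π (range ι)ᶜ
  submersion : ∀ x ∉ range ι, Function.Surjective (mfderiv (𝓡 d) (𝓡 1) π x)
  trivialization : ∃ δ φ, IsBindingTrivialization d k ι π δ φ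

/-- The page `P_t`: the closure of the fibre over `t` of `π : M \ B → S¹`. -/
def page (ι : B → M) (π : M → Circle) (t : Circle) : Set M :=
  closure {x | x ∉ range ι ∧ π x = t}

/-- The value `dθ(dπ(v))`, where `dθ` is the angular form of the circle. -/
def angularDeriv (π : M → Circle) (x : M) (v : TangentSpace (𝓡 d) x) : ℝ :=
  ((starRingEnd ℂ) (π x : ℂ) *
    (show ℂ from mfderiv (𝓡 d) 𝓘(ℝ, ℂ) (fun y : M => (π y : ℂ)) x v)).im

variable (k) in
/-- In an open book, `M` is oriented by `α ∧ (dα)^(m+1)` and the disc factor of a trivialization by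
`dx ∧ dy`; together they orient the binding (this is its orientation as the boundary of the pages,
which are cooriented by `π`). The condition says that `α_B ∧ (dα_B)^m` is positive for that
orientation. -/
def IsPositiveOnBinding (m : ℕ) (α : OneForm d M) (ι : B → M) (π : M → Circle) : Prop :=
  ∃ δ φ, IsBindingTrivialization d k ι π δ φ ∧
    ∀ (p : B) (v : Fin (2 * m + 1) → TangentSpace (𝓡 k) p),
      0 < (α.pullback ι : OneForm k B).wedgePow m p v →
      0 < α.wedgePow (m + 1) (ι p)
        (Matrix.vecCons
            (mfderiv ((𝓡 k).prod 𝓘(ℝ, ℂ)) (𝓡 d) φ (p, 0)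
              ((0, 1) : TangentSpace (𝓡 k) p × ℂ))
          (Matrix.vecCons
            (mfderiv ((𝓡 k).prod 𝓘(ℝ, ℂ)) (𝓡 d) φ (p, 0)
              ((0, Complex.I) : TangentSpace (𝓡 k) p × ℂ))
            (fun i => mfderiv (𝓡 k) (𝓡 d) ι p (v i))))

variable (k) in
/-- The contact form `α` on `M` (of dimension `2(m+1)+1`) supports the open book `(B, π)`: the
binding with `α_B` is a (positive) contact submanifold, and the Reeb vector field of `α` is
positively transverse to `π` off the binding and tangent to the binding. -/
structure Supports [IsManifold (𝓡 k) ∞ B] (m : ℕ) (α : OneForm d M) (ι : B → M)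
    (π : M → Circle) : Prop where
  contact_binding : (α.pullback ι : OneForm k B).IsContact m
  positive_binding : IsPositiveOnBinding k m α ι π
  reeb : ∃ R : ∀ x : M, TangentSpace (𝓡 d) x, α.IsReeb R ∧
    (∀ x ∉ range ι, 0 < angularDeriv π x (R x)) ∧
    (∀ p : B, R (ι p) ∈ range (mfderiv (𝓡 k) (𝓡 d) ι p))

end OpenBook

/-! ### Exact symplectic hypersurfaces with convex boundary -/

section Convex

variable {d : ℕ} {M : Type*} [TopologicalSpace M] [ChartedSpace (EuclideanSpace ℝ (Fin d)) M]

/-- `v` is the velocity at `x` of a smooth curve that starts at `x` and runs in `S` for small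
nonnegative times. -/
def IsVelocityInto (S : Set M) (x : M) (v : TangentSpace (𝓡 d) x) : Prop :=
  ∃ γ : ℝ → M, γ 0 = x ∧ ContMDiffAt 𝓘(ℝ, ℝ) (𝓡 d) ∞ γ 0 ∧ (∀ᶠ s in 𝓝[≥] (0 : ℝ), γ s ∈ S) ∧
    (mfderiv 𝓘(ℝ, ℝ) (𝓡 d) γ 0 (1 : ℝ) : EuclideanSpace ℝ (Fin d)) = v

/-- The tangent space at `x` of a submanifold (possibly with boundary) `S` of `M`, spanned by the
velocities of curves that run in `S`. -/
def tangentTo (S : Set M) (x : M) : Submodule ℝ (TangentSpace (𝓡 d) x) :=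
  Submodule.span ℝ {v | IsVelocityInto S x v}

variable (d) in
/-- `P` is a smoothly embedded hypersurface with boundary in `M`, and its boundary is `S`: in
suitable smooth charts `P` is a coordinate hyperplane `y_i = 0` near points off `S`; near points of
`S` it is the half hyperplane `y_i = 0, y_j ≥ 0`, and `S` is its edge `y_i = 0, y_j = 0`. -/
structure IsHypersurfaceWithBoundary (P S : Set M) : Prop where
  interior_chart : ∀ x ∈ P \ S, ∃ e ∈ IsManifold.maximalAtlas (𝓡 d) ∞ M, ∃ i : Fin d,
    x ∈ e.source ∧ ∀ y ∈ e.source, y ∈ P ↔ e y i = 0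
  boundary_chart : ∀ x ∈ S, ∃ e ∈ IsManifold.maximalAtlas (𝓡 d) ∞ M, ∃ i j : Fin d, i ≠ j ∧
    x ∈ e.source ∧ (∀ y ∈ e.source, y ∈ P ↔ e y i = 0 ∧ 0 ≤ e y j) ∧
    (∀ y ∈ e.source, y ∈ S ↔ e y i = 0 ∧ e y j = 0)

/-- `dα` restricts to a nondegenerate (symplectic) form on the submanifold `N`. -/
def IsSymplecticOn (α : OneForm d M) (N : Set M) : Prop :=
  ∀ x ∈ N, ∀ v ∈ tangentTo N x, (∀ w ∈ tangentTo N x, α.extD x v w = 0) → v = 0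

/-- `X` is the Liouville vector field of `α|_N` on the submanifold `N`: it is tangent to `N` and
`α|_N = i_X (dα|_N)`. When `dα|_N` is symplectic it is unique, and smooth if `α` is. -/
def IsLiouvilleField (α : OneForm d M) (N : Set M) (X : ∀ x : M, TangentSpace (𝓡 d) x) : Prop :=
  ∀ x ∈ N, X x ∈ tangentTo N x ∧ ∀ w ∈ tangentTo N x, α.extD x (X x) w = α x w

/-- At the point `x` of the boundary `S` of `P`, the vector `v` is transverse to `S` and points out
of `P`. -/
def IsOutward (P S : Set M) (x : M) (v : TangentSpace (𝓡 d) x) : Prop :=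
  v ∉ tangentTo S x ∧ IsVelocityInto P x (-v)

/-- The vector field `X`, given on `P \ S`, is transverse to the boundary `S` of `P` and points
outwards along it: after multiplication by a function `u` which is positive off `S`, it extends
smoothly over `S` by a vector field that is transverse to `S` and points out of `P`.
If `X` itself extends smoothly over `S`, then `u` is automatically positive along `S`, and the
condition says that the extension of `X` is transverse to `S` and points outwards. But `X` may also
blow up along `S`, which happens where the 2-form that defines it degenerates; then `u` tends to
zero there. -/
def IsOutwardAlong [IsManifold (𝓡 d) ∞ M] (P S : Set M) (X : ∀ x : M, TangentSpace (𝓡 d) x) :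
    Prop :=
  ∃ (U : Set M) (u : M → ℝ) (Y : ∀ x : M, TangentSpace (𝓡 d) x),
    IsOpen U ∧ S ⊆ U ∧ ContMDiffOn (𝓡 d) 𝓘(ℝ, ℝ) ∞ u U ∧
    ContMDiffOn (𝓡 d) (𝓡 d).tangent ∞ (fun x => (⟨x, Y x⟩ : TangentBundle (𝓡 d) M)) U ∧
    (∀ x ∈ (P \ S) ∩ U, 0 < u x ∧ Y x = u x • X x) ∧
    (∀ x ∈ S, IsOutward P S x (Y x))

/-- `S` is a convex boundary of `P` with respect to the Liouville form `α|_P`: `P` is a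
hypersurface with boundary `S`, `dα` is symplectic on the interior `P \ S`, and the Liouville vector
field of `α` on `P \ S` is transverse to `S` and points outwards. -/
structure HasConvexBoundary [IsManifold (𝓡 d) ∞ M] (α : OneForm d M) (P S : Set M) : Prop where
  hypersurface : IsHypersurfaceWithBoundary d P S
  symplectic : IsSymplecticOn α (P \ S)
  convex : ∃ X : ∀ x : M, TangentSpace (𝓡 d) x, IsLiouvilleField α (P \ S) X ∧ IsOutwardAlong P S X

end Convex

end

/-!
The bilinear form `A = dα + α ⊗ α` of a contact form `α` is nondegenerate at every point
(`OneForm.IsContact.existsUnique`): a vector annihilated by `dα` and `α` would make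
`α ∧ (dα)^n` vanish. All vector fields below are solutions of equations `A(Y, ·) = β`, and they are
smooth whenever `β` is, because `A` can be inverted in coordinates.

Off the binding the page over `t` is, locally, the zero set of `f = Im (t̄ π)` (`fibreFunction`), and
`df(R) > 0` for the Reeb field `R`. Hence the tangent spaces of the page are complements of the line
spanned by `R`, which is the kernel of `dα`. So `dα` is symplectic there, and the Liouville field
is the solution `X` of `A(X, ·) = α - df / df(R)`, which satisfies `df(X) = 0`.

Near the binding let `ζ = t̄ z` be the rotated disc coordinate (`discCoord`) and `η = Im ζ`. The page
is the half-plane `η = 0`, `Re ζ ≥ 0`, and the binding is its edge. On the interior of the page `dη`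
is the multiple `|ζ| df` of `df`. Put `u = dη(R)` and let `Y` solve `A(Y, ·) = u α - dη`
(`OneForm.IsContact.rescaledLiouville`). Both are smooth on the whole neighbourhood, and on the
interior of the page `u > 0` and `Y = u X`.

It remains to find `Y` at a point of the binding, where `u = 0` since `R` is tangent to the binding.
Let `W` be the tangent space of the binding. As `α` restricts to a contact form on the binding, every
vector can be projected along `W` to the plane of vectors that are annihilated by `α` and are
`dα`-orthogonal to `W`. Let `E₁`, `E₂` be the projections of the disc directions `∂ₓ`, `∂_y`. Then
`α ∧ (dα)^(m+1)` on `∂ₓ, ∂_y` and a basis of `W` is a positive multiple of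
`dα(E₁, E₂)` times the value of `α ∧ (dα)^m` on the basis, so the orientation hypothesis says that
`dα(E₁, E₂) > 0`. The equation `A(Y, ·) = -dη` then gives `dζ(Y) = -1 / dα(E₁, E₂)`
(`disc_component_of_contact_pair`): the vector `Y` is tangent to the half-plane and points out of it.
-/

noncomputable section

/-! ### The forms `a ∧ Ω^n` on a vector space -/

section WedgePower

variable {V : Type*}

/-- The product `a ⊗ Ω ⊗ ⋯ ⊗ Ω`, whose antisymmetrization is `2^n` times `a ∧ Ω^n`. -/
def wedgeTerm (n : ℕ) (a : V → ℝ) (Ω : V → V → ℝ) (v : Fin (2 * n + 1) → V) : ℝ :=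
  a (v 0) * ∏ i : Fin n, Ω (v ⟨2 * i + 1, by omega⟩) (v ⟨2 * i + 2, by omega⟩)

/-- The alternating sum that computes `2^n` times `a ∧ Ω^n`. -/
def wedgeSum (n : ℕ) (a : V → ℝ) (Ω : V → V → ℝ) (v : Fin (2 * n + 1) → V) : ℝ :=
  ∑ σ : Equiv.Perm (Fin (2 * n + 1)), ((Equiv.Perm.sign σ : ℤ) : ℝ) * wedgeTerm n a Ω (v ∘ σ)

/-- Every position enters a factor, so the term vanishes if one of the vectors is in the kernel of `a`
and of `Ω`. -/
theorem wedgeTerm_eq_zero {n : ℕ} {a : V → ℝ} {Ω : V → V → ℝ} {u : V} (ha : a u = 0)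
    (hl : ∀ w, Ω u w = 0) (hr : ∀ w, Ω w u = 0) {v : Fin (2 * n + 1) → V}
    (j : Fin (2 * n + 1)) (hj : v j = u) : wedgeTerm n a Ω v = 0 := by
  unfold wedgeTerm
  obtain ⟨j, hjlt⟩ := j
  rcases Nat.eq_zero_or_pos j with rfl | hpos
  · have : v 0 = u := hj
    rw [this, ha, zero_mul]
  · have hi : (j - 1) / 2 < n := by omega
    refine mul_eq_zero_of_right _ (Finset.prod_eq_zero (Finset.mem_univ ⟨(j - 1) / 2, hi⟩) ?_)
    rcases Nat.even_or_odd' j with ⟨k, rfl | rfl⟩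
    · have : (⟨2 * ((2 * k - 1) / 2) + 2, by omega⟩ : Fin (2 * n + 1)) = ⟨2 * k, hjlt⟩ :=
        Fin.ext (by simp only; omega)
      simp only [this, hj, hr]
    · have : (⟨2 * ((2 * k + 1 - 1) / 2) + 1, by omega⟩ : Fin (2 * n + 1)) = ⟨2 * k + 1, hjlt⟩ :=
        Fin.ext (by simp only; omega)
      simp only [this, hj, hl]

theorem wedgeSum_eq_zero {n : ℕ} {a : V → ℝ} {Ω : V → V → ℝ} {u : V} (ha : a u = 0)
    (hl : ∀ w, Ω u w = 0) (hr : ∀ w, Ω w u = 0) {v : Fin (2 * n + 1) → V}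
    (j : Fin (2 * n + 1)) (hj : v j = u) : wedgeSum n a Ω v = 0 := by
  refine Finset.sum_eq_zero fun σ _ => ?_
  rw [wedgeTerm_eq_zero ha hl hr (σ.symm j) (by simpa using hj), mul_zero]

section Linear

variable [AddCommGroup V] [Module ℝ V]

/-- `wedgeTerm` is linear in each argument, because each argument enters exactly one factor. -/
theorem exists_linear_wedgeTerm_update (n : ℕ) (a : V →ₗ[ℝ] ℝ) (Ω : V →ₗ[ℝ] V →ₗ[ℝ] ℝ)
    (v : Fin (2 * n + 1) → V) (j : Fin (2 * n + 1)) :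
    ∃ L : V →ₗ[ℝ] ℝ, ∀ x, wedgeTerm n a (fun v w => Ω v w) (Function.update v j x) = L x := by
  obtain ⟨j, hjlt⟩ := j
  rcases Nat.eq_zero_or_pos j with rfl | hpos
  · refine ⟨(∏ i : Fin n, Ω (v ⟨2 * i + 1, by omega⟩) (v ⟨2 * i + 2, by omega⟩)) • a, fun x => ?_⟩
    have h0 : Function.update v ⟨0, hjlt⟩ x 0 = x := Function.update_self _ _ _
    simp only [wedgeTerm, h0, LinearMap.smul_apply, smul_eq_mul, mul_comm (a x)]
    congr 1
  · set i₀ : Fin n := ⟨(j - 1) / 2, by omega⟩ with hi₀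
    set K : ℝ := a (v 0) * ∏ i ∈ Finset.univ.erase i₀,
      Ω (v ⟨2 * i + 1, by omega⟩) (v ⟨2 * i + 2, by omega⟩) with hK
    have key : ∀ x, wedgeTerm n a (fun v w => Ω v w) (Function.update v ⟨j, hjlt⟩ x) =
        K * Ω (Function.update v ⟨j, hjlt⟩ x ⟨2 * i₀ + 1, by omega⟩)
          (Function.update v ⟨j, hjlt⟩ x ⟨2 * i₀ + 2, by omega⟩) := by
      intro x
      have h0 : Function.update v ⟨j, hjlt⟩ x 0 = v 0 :=
        Function.update_of_ne (by simp [Fin.ext_iff]; omega) _ _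
      rw [wedgeTerm, h0, ← Finset.mul_prod_erase _ _ (Finset.mem_univ i₀), hK]
      rw [mul_comm (Ω _ _), ← mul_assoc]
      congr 2
      refine Finset.prod_congr rfl fun i hi => ?_
      have hne : (i : ℕ) ≠ (j - 1) / 2 := fun h => (Finset.ne_of_mem_erase hi) (Fin.ext h)
      rw [Function.update_of_ne (by simp only [ne_eq, Fin.ext_iff]; omega),
        Function.update_of_ne (by simp only [ne_eq, Fin.ext_iff]; omega)]
    rcases Nat.even_or_odd' j with ⟨k, hk | hk⟩
    · refine ⟨K • Ω (v ⟨2 * i₀ + 1, by omega⟩), fun x => ?_⟩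
      have h2 : (⟨2 * i₀ + 2, by omega⟩ : Fin (2 * n + 1)) = ⟨j, hjlt⟩ :=
        Fin.ext (by simp only [hi₀]; omega)
      rw [key, h2, Function.update_self,
        Function.update_of_ne (by simp only [ne_eq, Fin.ext_iff, hi₀]; omega)]
      rfl
    · refine ⟨K • Ω.flip (v ⟨2 * i₀ + 2, by omega⟩), fun x => ?_⟩
      have h2 : (⟨2 * i₀ + 1, by omega⟩ : Fin (2 * n + 1)) = ⟨j, hjlt⟩ :=
        Fin.ext (by simp only [hi₀]; omega)
      rw [key, h2, Function.update_self,
        Function.update_of_ne (by simp only [ne_eq, Fin.ext_iff, hi₀]; omega)]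
      rfl

/-- `wedgeTerm` as a multilinear map. -/
def wedgeTermMultilinear (n : ℕ) (a : V →ₗ[ℝ] ℝ) (Ω : V →ₗ[ℝ] V →ₗ[ℝ] ℝ) :
    MultilinearMap ℝ (fun _ : Fin (2 * n + 1) => V) ℝ :=
  MultilinearMap.mk' (wedgeTerm n a fun v w => Ω v w)
    (fun v j x y => by
      obtain ⟨L, hL⟩ := exists_linear_wedgeTerm_update n a Ω v j
      simp only [hL, map_add])
    (fun v j c x => by
      obtain ⟨L, hL⟩ := exists_linear_wedgeTerm_update n a Ω v j
      simp only [hL, map_smul])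

/-- `2^n` times `a ∧ Ω^n`, as an alternating map. -/
def wedgeAlternating (n : ℕ) (a : V →ₗ[ℝ] ℝ) (Ω : V →ₗ[ℝ] V →ₗ[ℝ] ℝ) :
    V [⋀^Fin (2 * n + 1)]→ₗ[ℝ] ℝ :=
  MultilinearMap.alternatization (wedgeTermMultilinear n a Ω)

theorem wedgeAlternating_apply (n : ℕ) (a : V →ₗ[ℝ] ℝ) (Ω : V →ₗ[ℝ] V →ₗ[ℝ] ℝ)
    (v : Fin (2 * n + 1) → V) :
    wedgeAlternating n a Ω v = wedgeSum n a (fun v w => Ω v w) v := by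
  rw [wedgeAlternating, MultilinearMap.alternatization_apply, wedgeSum]
  refine Finset.sum_congr rfl fun σ _ => ?_
  rw [Units.smul_def, zsmul_eq_mul]
  rfl

end Linear

/-! ### Splitting off a symplectic pair -/

/-- The permutation that exchanges the `i`-th pair of arguments of `Ω` with the last pair. -/
def pairSwap (n : ℕ) (i : Fin (n + 1)) : Equiv.Perm (Fin (2 * (n + 1) + 1)) :=
  Equiv.swap ⟨2 * i + 1, by omega⟩ ⟨2 * n + 1, by omega⟩ *
    Equiv.swap ⟨2 * i + 2, by omega⟩ ⟨2 * n + 2, by omega⟩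

theorem Fin.val_swap_apply {N : ℕ} (a b x : Fin N) : (Equiv.swap a b x : ℕ) =
    if (x : ℕ) = a then (b : ℕ) else if (x : ℕ) = b then (a : ℕ) else x := by
  simp only [Equiv.swap_apply_def, Fin.ext_iff]
  split_ifs <;> rfl

theorem sign_pairSwap (n : ℕ) (i : Fin (n + 1)) : Equiv.Perm.sign (pairSwap n i) = 1 := by
  rw [pairSwap, Equiv.Perm.sign_mul]
  by_cases h : (i : ℕ) = n
  · simp [h]
  · rw [Equiv.Perm.sign_swap (fun h' => h (by rw [Fin.ext_iff] at h'; simp only at h'; omega)),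
      Equiv.Perm.sign_swap (fun h' => h (by rw [Fin.ext_iff] at h'; simp only at h'; omega))]
    rfl

theorem pairSwap_zero (n : ℕ) (i : Fin (n + 1)) : pairSwap n i 0 = 0 := by
  rw [Fin.ext_iff, pairSwap, Equiv.Perm.mul_apply, Fin.val_swap_apply, Fin.val_swap_apply]
  simp

theorem pairSwap_odd (n : ℕ) (i k : Fin (n + 1)) : pairSwap n i ⟨2 * k + 1, by omega⟩ =
    ⟨2 * (Equiv.swap i (Fin.last n) k : Fin (n + 1)) + 1, by omega⟩ := by
  rw [Fin.ext_iff, pairSwap, Equiv.Perm.mul_apply, Fin.val_swap_apply, Fin.val_swap_apply]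
  simp only [Fin.val_swap_apply, Fin.val_last]
  split_ifs <;> omega

theorem pairSwap_even (n : ℕ) (i k : Fin (n + 1)) : pairSwap n i ⟨2 * k + 2, by omega⟩ =
    ⟨2 * (Equiv.swap i (Fin.last n) k : Fin (n + 1)) + 2, by omega⟩ := by
  rw [Fin.ext_iff, pairSwap, Equiv.Perm.mul_apply, Fin.val_swap_apply, Fin.val_swap_apply]
  simp only [Fin.val_swap_apply, Fin.val_last]
  split_ifs <;> omega

theorem wedgeTerm_comp_pairSwap (n : ℕ) (a : V → ℝ) (Ω : V → V → ℝ)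
    (v : Fin (2 * (n + 1) + 1) → V) (i : Fin (n + 1)) :
    wedgeTerm (n + 1) a Ω (v ∘ pairSwap n i) = wedgeTerm (n + 1) a Ω v := by
  unfold wedgeTerm
  simp only [Function.comp_apply, pairSwap_zero, pairSwap_odd, pairSwap_even]
  congr 1
  exact Equiv.prod_comp (Equiv.swap i (Fin.last n))
    (fun k : Fin (n + 1) => Ω (v ⟨2 * k + 1, by omega⟩) (v ⟨2 * k + 2, by omega⟩))

theorem wedgeTerm_comp_swap_last (n : ℕ) (a : V → ℝ) (Ω : V → V → ℝ) (hΩ : ∀ x y, Ω x y = -Ω y x)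
    (v : Fin (2 * (n + 1) + 1) → V) :
    wedgeTerm (n + 1) a Ω (v ∘ Equiv.swap ⟨2 * n + 1, by omega⟩ ⟨2 * n + 2, by omega⟩) =
      -wedgeTerm (n + 1) a Ω v := by
  unfold wedgeTerm
  rw [Fin.prod_univ_castSucc, Fin.prod_univ_castSucc]
  simp only [Function.comp_apply, Fin.val_castSucc, Fin.val_last, Equiv.swap_apply_left,
    Equiv.swap_apply_right]
  rw [Equiv.swap_apply_of_ne_of_ne (by simp [Fin.ext_iff]) (by simp [Fin.ext_iff]),
    hΩ (v ⟨2 * n + 2, _⟩)]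
  have : ∀ i : Fin n, Ω (v (Equiv.swap ⟨2 * n + 1, by omega⟩ ⟨2 * n + 2, by omega⟩
        (⟨2 * i + 1, by omega⟩ : Fin (2 * (n + 1) + 1))))
      (v (Equiv.swap ⟨2 * n + 1, by omega⟩ ⟨2 * n + 2, by omega⟩
        (⟨2 * i + 2, by omega⟩ : Fin (2 * (n + 1) + 1)))) =
      Ω (v ⟨2 * i + 1, by omega⟩) (v ⟨2 * i + 2, by omega⟩) := by
    intro i
    rw [Equiv.swap_apply_of_ne_of_ne (by simp only [ne_eq, Fin.ext_iff]; omega)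
      (by simp only [ne_eq, Fin.ext_iff]; omega),
      Equiv.swap_apply_of_ne_of_ne (by simp only [ne_eq, Fin.ext_iff]; omega)
      (by simp only [ne_eq, Fin.ext_iff]; omega)]
  rw [Finset.prod_congr rfl fun i _ => this i]
  ring

/-- The permutations that fix the last two positions contribute the sum for the remaining ones. -/
theorem sum_wedgeTerm_of_fix_last (n : ℕ) (a : V → ℝ) (Ω : V → V → ℝ)
    (w : Fin (2 * (n + 1) + 1) → V) :
    (∑ σ : Equiv.Perm (Fin (2 * (n + 1) + 1)),
      if σ ⟨2 * n + 1, by omega⟩ = ⟨2 * n + 1, by omega⟩ ∧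
          σ ⟨2 * n + 2, by omega⟩ = ⟨2 * n + 2, by omega⟩ then
        ((Equiv.Perm.sign σ : ℤ) : ℝ) * wedgeTerm (n + 1) a Ω (w ∘ σ) else 0) =
      Ω (w ⟨2 * n + 1, by omega⟩) (w ⟨2 * n + 2, by omega⟩) *
        wedgeSum n a Ω (fun k => w (Fin.castLE (by omega) k)) := by
  let f : Fin (2 * n + 1) ≃ {x : Fin (2 * (n + 1) + 1) // (x : ℕ) < 2 * n + 1} :=
    ⟨fun k => ⟨⟨k, by omega⟩, k.2⟩, fun x => ⟨x.1, x.2⟩, fun _ => rfl, fun _ => rfl⟩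
  have hf : ∀ (τ : Equiv.Perm (Fin (2 * n + 1))) (k : ℕ) (hk : k < 2 * n + 1),
      τ.extendDomain f ⟨k, by omega⟩ = Fin.castLE (by omega) (τ ⟨k, hk⟩) := fun τ k hk =>
    Equiv.Perm.extendDomain_apply_image τ f ⟨k, hk⟩
  have hp : ∀ τ : Equiv.Perm (Fin (2 * n + 1)), τ.extendDomain f ⟨2 * n + 1, by omega⟩ =
      ⟨2 * n + 1, by omega⟩ := fun τ =>
    Equiv.Perm.extendDomain_apply_not_subtype τ f (by simp)
  have hq : ∀ τ : Equiv.Perm (Fin (2 * n + 1)), τ.extendDomain f ⟨2 * n + 2, by omega⟩ =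
      ⟨2 * n + 2, by omega⟩ := fun τ =>
    Equiv.Perm.extendDomain_apply_not_subtype τ f (by simp)
  rw [wedgeSum, Finset.mul_sum, ← Finset.sum_filter]
  symm
  refine Finset.sum_bij (fun τ _ => τ.extendDomain f) (fun τ _ => ?_) (fun τ _ τ' _ h => ?_)
    (fun σ hσ => ?_) (fun τ _ => ?_)
  · simp [hp, hq]
  · exact Equiv.Perm.extendDomainHom_injective f h
  · obtain ⟨h1, h2⟩ := (Finset.mem_filter.1 hσ).2
    have hs : ∀ x : Fin (2 * (n + 1) + 1), ((σ x : Fin (2 * (n + 1) + 1)) : ℕ) < 2 * n + 1 ↔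
        (x : ℕ) < 2 * n + 1 := by
      intro x
      have e1 : (σ x : ℕ) = 2 * n + 1 ↔ (x : ℕ) = 2 * n + 1 := by
        constructor
        · intro h
          have : σ x = σ ⟨2 * n + 1, by omega⟩ := by rw [h1]; exact Fin.ext h
          exact congrArg Fin.val (σ.injective this)
        · intro h
          have : x = ⟨2 * n + 1, by omega⟩ := Fin.ext h
          rw [this, h1]
      have e2 : (σ x : ℕ) = 2 * n + 2 ↔ (x : ℕ) = 2 * n + 2 := by
        constructor
        · intro h
          have : σ x = σ ⟨2 * n + 2, by omega⟩ := by rw [h2]; exact Fin.ext h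
          exact congrArg Fin.val (σ.injective this)
        · intro h
          have : x = ⟨2 * n + 2, by omega⟩ := Fin.ext h
          rw [this, h2]
      omega
    refine ⟨f.permCongr.symm (σ.subtypePerm hs), Finset.mem_univ _, ?_⟩
    ext x
    rcases Nat.lt_trichotomy (x : ℕ) (2 * n + 1) with hx | hx | hx
    · have := hf (f.permCongr.symm (σ.subtypePerm hs)) x hx
      simp only [Fin.eta] at this
      rw [this]
      rfl
    · have : x = ⟨2 * n + 1, by omega⟩ := Fin.ext hx
      rw [this, hp, h1]
    · have : x = ⟨2 * n + 2, by omega⟩ := Fin.ext (by simp only; omega)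
      rw [this, hq, h2]
  · have h0 : τ.extendDomain f 0 = Fin.castLE (by omega) (τ 0) := hf τ 0 (by omega)
    rw [Equiv.Perm.sign_extendDomain]
    unfold wedgeTerm
    rw [Fin.prod_univ_castSucc]
    simp only [Function.comp_apply, Fin.val_castSucc, Fin.val_last, hp, hq, h0]
    have : ∀ i : Fin n, Ω (w (τ.extendDomain f ⟨2 * i + 1, by omega⟩))
        (w (τ.extendDomain f ⟨2 * i + 2, by omega⟩)) =
        Ω (w (Fin.castLE (by omega) (τ ⟨2 * i + 1, by omega⟩)))
          (w (Fin.castLE (by omega) (τ ⟨2 * i + 2, by omega⟩))) := by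
      intro i
      rw [hf τ (2 * i + 1) (by omega), hf τ (2 * i + 2) (by omega)]
    rw [Finset.prod_congr rfl fun i _ => this i]
    ring

/-- If the last two vectors are annihilated by `a` and `Ω`-orthogonal to the other ones, they split
off from `a ∧ Ω^(n+1)`: in each nonzero term they are the two arguments of one factor `Ω`. -/
theorem wedgeSum_succ_of_orthogonal (n : ℕ) (a : V → ℝ) (Ω : V → V → ℝ)
    (hΩ : ∀ x y, Ω x y = -Ω y x) (w : Fin (2 * (n + 1) + 1) → V)
    (ha : a (w ⟨2 * n + 1, by omega⟩) = 0)
    (h1 : ∀ k : Fin (2 * (n + 1) + 1), k ≠ ⟨2 * n + 2, by omega⟩ →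
      Ω (w ⟨2 * n + 1, by omega⟩) (w k) = 0) :
    wedgeSum (n + 1) a Ω w = 2 * (n + 1) * (Ω (w ⟨2 * n + 1, by omega⟩) (w ⟨2 * n + 2, by omega⟩) *
        wedgeSum n a Ω (fun k => w (Fin.castLE (by omega) k))) := by
  set p : Fin (2 * (n + 1) + 1) := ⟨2 * n + 1, by omega⟩ with hp
  set q : Fin (2 * (n + 1) + 1) := ⟨2 * n + 2, by omega⟩ with hq
  set T : Equiv.Perm (Fin (2 * (n + 1) + 1)) → ℝ := fun σ =>
    ((Equiv.Perm.sign σ : ℤ) : ℝ) * wedgeTerm (n + 1) a Ω (w ∘ σ) with hT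
  set l : Fin (n + 1) → Fin (2 * (n + 1) + 1) := fun i => ⟨2 * i + 1, by omega⟩ with hl
  set r : Fin (n + 1) → Fin (2 * (n + 1) + 1) := fun i => ⟨2 * i + 2, by omega⟩ with hr
  have hzero : ∀ σ (i : Fin (n + 1)), Ω (w (σ (l i))) (w (σ (r i))) = 0 → T σ = 0 := by
    intro σ i h
    have : wedgeTerm (n + 1) a Ω (w ∘ σ) = 0 :=
      mul_eq_zero_of_right _ (Finset.prod_eq_zero (Finset.mem_univ i) h)
    simp only [hT, this, mul_zero]
  -- a nonzero term pairs `p` with `q` in exactly one factor, in one of the two orders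
  have hsplit : ∀ σ, T σ = ∑ i : Fin (n + 1), ((if σ (l i) = p ∧ σ (r i) = q then T σ else 0) +
      if σ (l i) = q ∧ σ (r i) = p then T σ else 0) := by
    intro σ
    by_cases hTσ : T σ = 0
    · simp [hTσ]
    have hpos : (σ.symm p : ℕ) ≠ 0 := by
      intro h
      refine hTσ ?_
      have h0 : σ 0 = p := by
        rw [← Equiv.apply_symm_apply σ p]
        exact congrArg σ (Fin.ext h.symm)
      have : wedgeTerm (n + 1) a Ω (w ∘ σ) = 0 := by
        refine mul_eq_zero_of_left ?_ _
        rw [Function.comp_apply, h0, ha]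
      simp only [hT, this, mul_zero]
    have hval : ∀ x : Fin (2 * (n + 1) + 1), σ x = p → x = σ.symm p := fun x hx => by
      rw [← hx, Equiv.symm_apply_apply]
    set i₀ : Fin (n + 1) := ⟨((σ.symm p : ℕ) - 1) / 2, by omega⟩ with hi₀
    have hother : ∀ i ∈ Finset.univ, i ≠ i₀ →
        ((if σ (l i) = p ∧ σ (r i) = q then T σ else 0) +
          if σ (l i) = q ∧ σ (r i) = p then T σ else 0) = 0 := by
      intro i _ hi
      rw [if_neg, if_neg, add_zero]
      · rintro ⟨-, h⟩
        have := congrArg Fin.val (hval _ h)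
        refine hi (Fin.ext ?_)
        simp only [hr, hi₀] at this ⊢
        omega
      · rintro ⟨h, -⟩
        have := congrArg Fin.val (hval _ h)
        refine hi (Fin.ext ?_)
        simp only [hl, hi₀] at this ⊢
        omega
    rw [Finset.sum_eq_single i₀ hother (by simp)]
    have hpq : p ≠ q := by simp [hp, hq, Fin.ext_iff]
    rcases Nat.even_or_odd' (σ.symm p : ℕ) with ⟨k, hk | hk⟩
    · have hr0 : σ (r i₀) = p := by
        rw [← Equiv.apply_symm_apply σ p]
        exact congrArg σ (Fin.ext (by simp only [hr, hi₀]; omega))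
      have hl0 : σ (l i₀) = q := by
        by_contra hne
        refine hTσ (hzero σ i₀ ?_)
        rw [hr0, hΩ, h1 _ hne, neg_zero]
      rw [if_neg (fun h => hpq (hr0.symm.trans h.2)), if_pos ⟨hl0, hr0⟩, zero_add]
    · have hl0 : σ (l i₀) = p := by
        rw [← Equiv.apply_symm_apply σ p]
        exact congrArg σ (Fin.ext (by simp only [hl, hi₀]; omega))
      have hr0 : σ (r i₀) = q := by
        by_contra hne
        refine hTσ (hzero σ i₀ ?_)
        rw [hl0, h1 _ hne]
      rw [if_pos ⟨hl0, hr0⟩, if_neg (fun h => hpq (hl0.symm.trans h.1)), add_zero]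
  -- by symmetry all factors and both orders contribute the same amount
  have hshift : ∀ (i : Fin (n + 1)) (x y : Fin (2 * (n + 1) + 1)),
      (∑ σ, if σ (l i) = x ∧ σ (r i) = y then T σ else 0) =
        ∑ σ, if σ p = x ∧ σ q = y then T σ else 0 := by
    intro i x y
    rw [← Equiv.sum_comp (Equiv.mulRight (pairSwap n i))]
    refine Finset.sum_congr rfl fun σ _ => ?_
    have e1 : pairSwap n i (l i) = p := by
      rw [hl]; simp only [pairSwap_odd, Equiv.swap_apply_left, Fin.val_last]; rfl
    have e2 : pairSwap n i (r i) = q := by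
      rw [hr]; simp only [pairSwap_even, Equiv.swap_apply_left, Fin.val_last]; rfl
    have e3 : T (σ * pairSwap n i) = T σ := by
      simp only [hT, Equiv.Perm.sign_mul, sign_pairSwap, mul_one, Equiv.Perm.coe_mul,
        ← Function.comp_assoc, wedgeTerm_comp_pairSwap]
    simp only [Equiv.coe_mulRight, Equiv.Perm.mul_apply, e1, e2, e3]
  have hflip : (∑ σ, if σ p = q ∧ σ q = p then T σ else 0) =
      ∑ σ, if σ p = p ∧ σ q = q then T σ else 0 := by
    rw [← Equiv.sum_comp (Equiv.mulRight (Equiv.swap p q))]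
    refine Finset.sum_congr rfl fun σ _ => ?_
    have e3 : T (σ * Equiv.swap p q) = T σ := by
      simp only [hT, Equiv.Perm.sign_mul, Equiv.Perm.coe_mul, ← Function.comp_assoc]
      rw [wedgeTerm_comp_swap_last n a Ω hΩ,
        Equiv.Perm.sign_swap (show p ≠ q by simp [hp, hq, Fin.ext_iff])]
      simp
    simp only [Equiv.coe_mulRight, Equiv.Perm.mul_apply, Equiv.swap_apply_left,
      Equiv.swap_apply_right, e3, and_comm]
  calc wedgeSum (n + 1) a Ω w = ∑ σ, T σ := rfl
    _ = ∑ i : Fin (n + 1), ((∑ σ, if σ (l i) = p ∧ σ (r i) = q then T σ else 0) +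
          ∑ σ, if σ (l i) = q ∧ σ (r i) = p then T σ else 0) := by
        rw [Finset.sum_congr rfl fun σ _ => hsplit σ, Finset.sum_comm]
        exact Finset.sum_congr rfl fun i _ => Finset.sum_add_distrib
    _ = 2 * (n + 1) * ∑ σ, if σ p = p ∧ σ q = q then T σ else 0 := by
        simp only [hshift, hflip, Finset.sum_const, Finset.card_univ, Fintype.card_fin,
          nsmul_eq_mul]
        push_cast
        ring
    _ = _ := by rw [← sum_wedgeTerm_of_fix_last n a Ω w]

end WedgePower

/-! ### Contact pairs on a vector space -/

section ContactPair

variable {V : Type*} [AddCommGroup V] [Module ℝ V]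

/-- If `a ∧ Ω^n` is a nonzero form of top degree, then `ker a ∩ ker Ω = 0`. -/
theorem eq_zero_of_wedgeSum_ne_zero [Module.Finite ℝ V] {n : ℕ}
    (hV : Module.finrank ℝ V = 2 * n + 1) {a : V →ₗ[ℝ] ℝ} {Ω : V →ₗ[ℝ] V →ₗ[ℝ] ℝ}
    (hΩ : ∀ x y, Ω x y = -Ω y x) {v : Fin (2 * n + 1) → V}
    (hv : wedgeSum n a (fun v w => Ω v w) v ≠ 0) {u : V} (ha : a u = 0) (hu : ∀ w, Ω u w = 0) :
    u = 0 := by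
  rw [← wedgeAlternating_apply] at hv
  have hli : LinearIndependent ℝ v := by
    by_contra h
    exact hv (AlternatingMap.map_linearDependent _ v h)
  let b : Module.Basis (Fin (2 * n + 1)) ℝ V :=
    basisOfLinearIndependentOfCardEqFinrank hli (by simp [hV])
  have hb : ∀ i, b i = v i := fun i => by simp [b]
  have hur : ∀ w, Ω w u = 0 := fun w => by rw [hΩ, hu, neg_zero]
  rw [← b.sum_repr u]
  refine Finset.sum_eq_zero fun j _ => ?_
  have h1 : wedgeAlternating n a Ω (Function.update v j u) = 0 := by
    rw [wedgeAlternating_apply]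
    exact wedgeSum_eq_zero ha hu hur j (Function.update_self _ _ _)
  have h2 : wedgeAlternating n a Ω (Function.update v j u) =
      b.repr u j * wedgeAlternating n a Ω v := by
    conv_lhs => rw [← b.sum_repr u]
    rw [AlternatingMap.map_update_sum, Finset.sum_eq_single j]
    · rw [AlternatingMap.map_update_smul, hb, Function.update_eq_self, smul_eq_mul]
    · intro i _ hij
      rw [AlternatingMap.map_update_smul, hb, AlternatingMap.map_update_self _ _ hij.symm, smul_zero]
    · simp
  rw [h1] at h2
  rw [(mul_eq_zero.1 h2.symm).resolve_right hv, zero_smul]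

/-- The bilinear form `Ω + a ⊗ a` attached to a 1-form and a 2-form. It is nondegenerate when
`(a, Ω)` is a contact pair. -/
def contactBilin (a : V →ₗ[ℝ] ℝ) (Ω : V →ₗ[ℝ] V →ₗ[ℝ] ℝ) : V →ₗ[ℝ] V →ₗ[ℝ] ℝ :=
  Ω + (LinearMap.toSpanSingleton ℝ (V →ₗ[ℝ] ℝ) a).comp a

theorem contactBilin_apply (a : V →ₗ[ℝ] ℝ) (Ω : V →ₗ[ℝ] V →ₗ[ℝ] ℝ) (v w : V) :
    contactBilin a Ω v w = Ω v w + a v * a w := by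
  simp [contactBilin]

theorem contactBilin_injective [Module.Finite ℝ V] {n : ℕ}
    (hV : Module.finrank ℝ V = 2 * n + 1) {a : V →ₗ[ℝ] ℝ} {Ω : V →ₗ[ℝ] V →ₗ[ℝ] ℝ}
    (hΩ : ∀ x y, Ω x y = -Ω y x) {v : Fin (2 * n + 1) → V}
    (hv : wedgeSum n a (fun v w => Ω v w) v ≠ 0) : Function.Injective (contactBilin a Ω) := by
  rw [injective_iff_map_eq_zero]
  intro u hu
  have h : ∀ w, Ω u w + a u * a w = 0 := fun w => by
    rw [← contactBilin_apply, hu, LinearMap.zero_apply]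
  have h1 : Ω u u = 0 := by linarith [hΩ u u]
  have h2 : a u = 0 := by
    have := h u
    rw [h1, zero_add] at this
    exact mul_self_eq_zero.1 this
  exact eq_zero_of_wedgeSum_ne_zero hV hΩ hv h2 fun w => by simpa [h2] using h w

theorem contactBilin_surjective [Module.Finite ℝ V] {n : ℕ}
    (hV : Module.finrank ℝ V = 2 * n + 1) {a : V →ₗ[ℝ] ℝ} {Ω : V →ₗ[ℝ] V →ₗ[ℝ] ℝ}
    (hΩ : ∀ x y, Ω x y = -Ω y x) {v : Fin (2 * n + 1) → V}
    (hv : wedgeSum n a (fun v w => Ω v w) v ≠ 0) : Function.Surjective (contactBilin a Ω) :=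
  (LinearMap.injective_iff_surjective_of_finrank_eq_finrank
    (Subspace.dual_finrank_eq (K := ℝ) (V := V)).symm).1 (contactBilin_injective hV hΩ hv)

/-- `(a ∧ Ω^(n+1))(e₁, e₂, v) = (n+1) Ω(e₁, e₂) (a ∧ Ω^n)(v)` if `e₁`, `e₂` are annihilated by `a`
and are `Ω`-orthogonal to `v` (up to the normalization of `wedgeSum`). -/
theorem wedgeSum_vecCons_vecCons (n : ℕ) (a : V →ₗ[ℝ] ℝ) (Ω : V →ₗ[ℝ] V →ₗ[ℝ] ℝ)
    (hΩ : ∀ x y, Ω x y = -Ω y x) (e₁ e₂ : V) (v : Fin (2 * n + 1) → V) (ha : a e₁ = 0)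
    (h1 : ∀ k, Ω e₁ (v k) = 0) :
    wedgeSum (n + 1) a (fun v w => Ω v w) (Matrix.vecCons e₁ (Matrix.vecCons e₂ v)) =
      2 * (n + 1) * (Ω e₁ e₂ * wedgeSum n a (fun v w => Ω v w) v) := by
  set w : Fin (2 * (n + 1) + 1) → V := Matrix.vecCons e₁ (Matrix.vecCons e₂ v) with hw
  set ρ : Equiv.Perm (Fin (2 * (n + 1) + 1)) := finRotate _ ^ 2 with hρ
  have hrot : ∀ k (hk : k < 2 * (n + 1)), finRotate (2 * (n + 1) + 1) ⟨k, by omega⟩ =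
      ⟨k + 1, by omega⟩ := fun k hk => finRotate_of_lt hk
  have hlast : finRotate (2 * (n + 1) + 1) ⟨2 * n + 2, by omega⟩ = ⟨0, by omega⟩ :=
    finRotate_last
  have hρp : w (ρ ⟨2 * n + 1, by omega⟩) = e₁ := by
    rw [hρ, pow_two, Equiv.Perm.mul_apply, hrot (2 * n + 1) (by omega)]
    exact congrArg w hlast
  have hρq : w (ρ ⟨2 * n + 2, by omega⟩) = e₂ := by
    rw [hρ, pow_two, Equiv.Perm.mul_apply, hlast, hrot 0 (by omega)]
    rfl
  have hρk : ∀ k (hk : k < 2 * n + 1), w (ρ ⟨k, by omega⟩) = v ⟨k, hk⟩ := by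
    intro k hk
    rw [hρ, pow_two, Equiv.Perm.mul_apply, hrot k (by omega), hrot (k + 1) (by omega)]
    rfl
  have hsign : Equiv.Perm.sign ρ = 1 := by
    rw [hρ, map_pow, sign_finRotate, ← pow_mul]
    exact Even.neg_one_pow ⟨2 * (n + 1), by omega⟩
  have hperm := AlternatingMap.map_perm (wedgeAlternating (n + 1) a Ω) w ρ
  rw [hsign, one_smul, wedgeAlternating_apply, wedgeAlternating_apply] at hperm
  rw [← hperm, wedgeSum_succ_of_orthogonal n a (fun v w => Ω v w) hΩ]
  · simp only [Function.comp_apply, hρp, hρq]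
    congr 3
    funext k
    exact hρk k k.2
  · simp only [Function.comp_apply, hρp, ha]
  · intro k hk
    simp only [Function.comp_apply, hρp]
    rcases Nat.lt_trichotomy (k : ℕ) (2 * n + 1) with h | h | h
    · rw [show w (ρ k) = v ⟨k, h⟩ from hρk k h, h1]
    · rw [show k = ⟨2 * n + 1, by omega⟩ from Fin.ext h, hρp]
      linarith [hΩ e₁ e₁]
    · exact absurd (Fin.ext (by simp only; omega)) hk

variable {W : Type*} [AddCommGroup W] [Module ℝ W]

/-- The linear algebra at a point of the binding. Here `W ⊆ V` is the tangent space of the binding,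
`H` the derivative of the rotated disc coordinate, and `Y` the rescaled Liouville vector. The `Ω`-complement of `W` in `ker a` is spanned by projections `E₁`, `E₂` of
`X₁`, `X₂`; the orientation hypothesis says that `Ω(E₁, E₂) > 0`, and the equation for `Y` then gives
`H Y = -1 / Ω(E₁, E₂)`. -/
theorem disc_component_of_contact_pair [Module.Finite ℝ W] {n : ℕ}
    (hW : Module.finrank ℝ W = 2 * n + 1) {a : V →ₗ[ℝ] ℝ} {Ω : V →ₗ[ℝ] V →ₗ[ℝ] ℝ}
    (hΩ : ∀ x y, Ω x y = -Ω y x) (j : W →ₗ[ℝ] V)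
    {v₀ : Fin (2 * n + 1) → W}
    (hv₀ : wedgeSum n (fun w => a (j w)) (fun w w' => Ω (j w) (j w')) v₀ ≠ 0)
    {R : W} (haR : a (j R) = 1) (hR : ∀ v, Ω (j R) v = 0)
    (X₁ X₂ : V) (hpos : ∀ v : Fin (2 * n + 1) → W,
      0 < wedgeSum n (fun w => a (j w)) (fun w w' => Ω (j w) (j w')) v →
      0 < wedgeSum (n + 1) a (fun v w => Ω v w)
        (Matrix.vecCons X₁ (Matrix.vecCons X₂ (fun i => j (v i)))))
    (H : V →ₗ[ℝ] ℂ) (hH : ∀ v, H v = 0 ↔ v ∈ LinearMap.range j)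
    {c : ℂ} (hc : ‖c‖ = 1) (hX₁ : H X₁ = starRingEnd ℂ c) (hX₂ : H X₂ = starRingEnd ℂ c * Complex.I)
    {Y : V} (hY : ∀ w, contactBilin a Ω Y w = -(H w).im) :
    (H Y).im = 0 ∧ (H Y).re < 0 := by
  have hHj : ∀ w, H (j w) = 0 := fun w => (hH _).2 ⟨w, rfl⟩
  set aW : W →ₗ[ℝ] ℝ := a.comp j with haW
  set ΩW : W →ₗ[ℝ] W →ₗ[ℝ] ℝ := Ω.compl₁₂ j j with hΩW
  have hΩW' : ∀ x y, ΩW x y = -ΩW y x := fun x y => hΩ _ _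
  have hv₀' : wedgeSum n aW (fun v w => ΩW v w) v₀ ≠ 0 := hv₀
  have hΩR : ∀ v, Ω v (j R) = 0 := fun v => by rw [hΩ, hR, neg_zero]
  -- the projection of a vector to the complement of `W`
  have proj : ∀ X : V, ∃ b : W, a (X - j b) = 0 ∧ ∀ w, Ω (X - j b) (j w) = 0 := by
    intro X
    obtain ⟨b, hb⟩ := contactBilin_surjective hW hΩW' hv₀' ((contactBilin a Ω X).comp j)
    have hb' : ∀ w, Ω (X - j b) (j w) + a (X - j b) * a (j w) = 0 := by
      intro w
      have := LinearMap.congr_fun hb w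
      rw [LinearMap.comp_apply, contactBilin_apply, contactBilin_apply] at this
      change Ω (j b) (j w) + a (j b) * a (j w) = Ω X (j w) + a X * a (j w) at this
      rw [map_sub, map_sub, LinearMap.sub_apply]
      linarith
    have h0 : a (X - j b) = 0 := by simpa [hΩR, haR] using hb' R
    exact ⟨b, h0, fun w => by simpa [h0] using hb' w⟩
  obtain ⟨b₁, ha₁, hΩ₁⟩ := proj X₁
  obtain ⟨b₂, ha₂, hΩ₂⟩ := proj X₂
  set E₁ := X₁ - j b₁ with hE₁
  set E₂ := X₂ - j b₂ with hE₂
  have hHE₁ : H E₁ = starRingEnd ℂ c := by rw [hE₁, map_sub, hHj, sub_zero, hX₁]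
  have hHE₂ : H E₂ = starRingEnd ℂ c * Complex.I := by rw [hE₂, map_sub, hHj, sub_zero, hX₂]
  -- the sign of `Ω E₁ E₂`
  obtain ⟨v, hv⟩ : ∃ v, 0 < wedgeSum n aW (fun v w => ΩW v w) v := by
    rcases lt_or_gt_of_ne hv₀' with h | h
    · refine ⟨Function.update v₀ 0 ((-1 : ℝ) • v₀ 0), ?_⟩
      rw [← wedgeAlternating_apply, AlternatingMap.map_update_smul, Function.update_eq_self,
        wedgeAlternating_apply]
      simpa using h
    · exact ⟨v₀, h⟩
  let C : V → V → (Fin (2 * (n + 1) + 1) → V) := fun X Z =>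
    Matrix.vecCons X (Matrix.vecCons Z (fun i => j (v i)))
  -- replacing `X₁`, `X₂` by `E₁`, `E₂` adds terms whose arguments include `2n+2` vectors of `W`
  have hnot : ∀ b : W, ¬ LinearIndependent ℝ (Fin.cons (j b) (fun i => j (v i)) :
      Fin (2 * n + 1 + 1) → V) := by
    intro b h
    have h' : LinearIndependent ℝ (Fin.cons b v : Fin (2 * n + 1 + 1) → W) := by
      refine LinearIndependent.of_comp j ?_
      convert h using 1
      funext i
      refine Fin.cases ?_ (fun i => ?_) i <;> rfl
    have := h'.fintype_card_le_finrank
    simp [hW] at this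
  have hdep₁ : ∀ (b : W) (X : V), wedgeAlternating (n + 1) a Ω (C (j b) X) = 0 := by
    intro b X
    refine AlternatingMap.map_linearDependent _ _ fun h => hnot b ?_
    have hinj : Function.Injective (Fin.cons 0 (fun i : Fin (2 * n + 1) => i.succ.succ) :
        Fin (2 * n + 1 + 1) → Fin (2 * n + 1 + 1 + 1)) := by
      rw [Fin.cons_injective_iff]
      refine ⟨?_, (Fin.succ_injective _).comp (Fin.succ_injective _)⟩
      rintro ⟨i, hi⟩
      exact Fin.succ_ne_zero _ hi
    have heq : (Fin.cons (j b) (fun i => j (v i)) : Fin (2 * n + 1 + 1) → V) =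
        C (j b) X ∘ (Fin.cons 0 (fun i : Fin (2 * n + 1) => i.succ.succ) :
          Fin (2 * n + 1 + 1) → Fin (2 * n + 1 + 1 + 1)) := by
      funext i
      refine Fin.cases ?_ (fun i => ?_) i <;> rfl
    rw [heq]
    exact h.comp _ hinj
  have hdep₂ : ∀ (b : W) (X : V), wedgeAlternating (n + 1) a Ω (C X (j b)) = 0 := by
    intro b X
    refine AlternatingMap.map_linearDependent _ _ fun h => hnot b ?_
    exact h.comp (Fin.succ : Fin (2 * n + 1 + 1) → _) (Fin.succ_injective _)
  have hEX : wedgeAlternating (n + 1) a Ω (C E₁ E₂) = wedgeAlternating (n + 1) a Ω (C X₁ X₂) := by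
    have s1 : ∀ X Z : V, wedgeAlternating (n + 1) a Ω (C (X - j b₁) Z) =
        wedgeAlternating (n + 1) a Ω (C X Z) := by
      intro X Z
      have hu : ∀ x : V, Function.update (C X Z) 0 x = C x Z :=
        fun x => Fin.update_cons_zero _ _ _
      have := AlternatingMap.map_update_sub (wedgeAlternating (n + 1) a Ω) (C X Z) 0 X (j b₁)
      rwa [hu, hu, hu, hdep₁ b₁ Z, sub_zero] at this
    have s2 : ∀ X Z : V, wedgeAlternating (n + 1) a Ω (C X (Z - j b₂)) =
        wedgeAlternating (n + 1) a Ω (C X Z) := by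
      intro X Z
      have hu : ∀ x : V, Function.update (C X Z) 1 x = C X x := by
        intro x
        funext k
        refine Fin.cases ?_ (fun k => Fin.cases ?_ (fun k => ?_) k) k <;> rfl
      have := AlternatingMap.map_update_sub (wedgeAlternating (n + 1) a Ω) (C X Z) 1 Z (j b₂)
      rwa [hu, hu, hu, hdep₂ b₂ X, sub_zero] at this
    rw [hE₁, hE₂, s1, s2]
  have hΩpos : 0 < Ω E₁ E₂ := by
    have h1 : 0 < wedgeSum (n + 1) a (fun v w => Ω v w) (C X₁ X₂) := hpos v hv
    have h0 : wedgeSum (n + 1) a (fun v w => Ω v w) (C E₁ E₂) = _ :=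
      wedgeSum_vecCons_vecCons n a Ω hΩ E₁ E₂ (fun i => j (v i)) ha₁ (fun k => hΩ₁ _)
    rw [← wedgeAlternating_apply, ← hEX, wedgeAlternating_apply, h0] at h1
    have h2 : (0 : ℝ) < 2 * (n + 1) := by positivity
    have h3 := (mul_pos_iff_of_pos_left h2).1 h1
    exact (pos_iff_pos_of_mul_pos h3).2 hv
  -- `Y` lies in the span of `E₁` and `E₂`
  have haY : a Y = 0 := by
    have := hY (j R)
    rwa [contactBilin_apply, hΩR, haR, hHj, zero_add, mul_one, Complex.zero_im, neg_zero] at this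
  have hY' : ∀ w, Ω Y w = -(H w).im := fun w => by
    rw [← hY w, contactBilin_apply, haY, zero_mul, add_zero]
  set z : ℂ := c * H Y with hz
  have hcc : starRingEnd ℂ c * c = 1 := by
    rw [mul_comm, Complex.mul_conj, Complex.normSq_eq_norm_sq, hc]; norm_num
  have hHY : H Y = starRingEnd ℂ c * z := by rw [hz, ← mul_assoc, hcc, one_mul]
  set D : V := Y - z.re • E₁ - z.im • E₂ with hD
  have hHD : H D = 0 := by
    rw [hD, map_sub, map_sub, map_smul, map_smul, hHE₁, hHE₂, hHY]
    conv_lhs => enter [1, 1]; rw [← Complex.re_add_im z]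
    simp only [Complex.real_smul]
    ring
  obtain ⟨d, hd⟩ := (hH D).1 hHD
  have hd0 : d = 0 := by
    refine eq_zero_of_wedgeSum_ne_zero hW hΩW' hv₀' ?_ fun w => ?_
    · change a (j d) = 0
      rw [hd, hD]
      simp [haY, ha₁, ha₂]
    · change Ω (j d) (j w) = 0
      rw [hd, hD]
      simp [hY', hΩ₁, hΩ₂, hHj]
  have hYE : Y = z.re • E₁ + z.im • E₂ := by
    rw [hd0, map_zero] at hd
    rw [← sub_eq_zero, ← sub_sub]
    exact hd.symm
  have hself : ∀ x, Ω x x = 0 := fun x => by linarith [hΩ x x]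
  have e1 : z.im * Ω E₁ E₂ = (H E₁).im := by
    have := hY' E₁
    rw [hYE] at this
    simp only [map_add, map_smul, LinearMap.add_apply, LinearMap.smul_apply, hself, smul_eq_mul,
      hΩ E₂ E₁] at this
    linarith
  have e2 : z.re * Ω E₁ E₂ = -(H E₂).im := by
    have := hY' E₂
    rw [hYE] at this
    simp only [map_add, map_smul, LinearMap.add_apply, LinearMap.smul_apply, hself, smul_eq_mul]
      at this
    linarith
  have hzc : z * (Ω E₁ E₂ : ℝ) = -c := by
    apply Complex.ext
    · rw [Complex.re_mul_ofReal, e2, hHE₂]; simp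
    · rw [Complex.im_mul_ofReal, e1, hHE₁]; simp
  have hfin : H Y * (Ω E₁ E₂ : ℝ) = -1 := by
    rw [hHY, mul_assoc, hzc, mul_neg, hcc]
  have hre := congrArg Complex.re hfin
  have him := congrArg Complex.im hfin
  rw [Complex.re_mul_ofReal] at hre
  rw [Complex.im_mul_ofReal] at him
  simp only [Complex.neg_re, Complex.one_re, Complex.neg_im, Complex.one_im, neg_zero] at hre him
  refine ⟨(mul_eq_zero.1 him).resolve_right hΩpos.ne', ?_⟩
  by_contra hneg
  rw [not_lt] at hneg
  have := mul_nonneg hneg hΩpos.le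
  linarith

end ContactPair

/-! ### One-forms in coordinates -/

namespace OneForm

variable {d k : ℕ} {M : Type*} [TopologicalSpace M] [ChartedSpace (EuclideanSpace ℝ (Fin d)) M]
  {B : Type*} [TopologicalSpace B] [ChartedSpace (EuclideanSpace ℝ (Fin k)) B]

/-- The local expression of `α` in the preferred chart at `x`, as a map to the dual space. -/
def coordForm (α : OneForm d M) (x : M) (y : EuclideanSpace ℝ (Fin d)) :
    EuclideanSpace ℝ (Fin d) →L[ℝ] ℝ :=
  (α ((chartAt (EuclideanSpace ℝ (Fin d)) x).symm y)).comp
    (mfderiv (𝓡 d) (𝓡 d) (chartAt (EuclideanSpace ℝ (Fin d)) x).symm y)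

theorem localRep_eq (α : OneForm d M) (x : M) : α.localRep x = fun y =>
    ContinuousAlternatingMap.ofSubsingleton ℝ (EuclideanSpace ℝ (Fin d)) ℝ 0 (α.coordForm x y) :=
  rfl

/-- The form is paired with the images of constant vector fields under the inverse chart. -/
theorem IsSmooth.contDiffOn_coordForm [IsManifold (𝓡 d) ∞ M] {α : OneForm d M} (h : α.IsSmooth)
    (x : M) : ContDiffOn ℝ ∞ (α.coordForm x) (chartAt (EuclideanSpace ℝ (Fin d)) x).target := by
  set e := chartAt (EuclideanSpace ℝ (Fin d)) x with he
  have hsymm : ContMDiffOn (𝓡 d) (𝓡 d) ∞ e.symm e.target := contMDiffOn_chart_symm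
  rw [contDiffOn_clm_apply]
  intro v
  rw [← contMDiffOn_iff_contDiffOn]
  have h1 : ContMDiffOn 𝓘(ℝ, EuclideanSpace ℝ (Fin d)) (𝓡 d).tangent ∞
      (fun y => (⟨e.symm y, mfderiv (𝓡 d) (𝓡 d) e.symm y v⟩ : TangentBundle (𝓡 d) M)) e.target := by
    have h2 := hsymm.contMDiffOn_tangentMapWithin (m := ∞) (by simp) e.open_target.uniqueMDiffOn
    have h3 : ContMDiff 𝓘(ℝ, EuclideanSpace ℝ (Fin d)) (𝓡 d).tangent ∞
        (fun y => (⟨y, v⟩ : TangentBundle (𝓡 d) (EuclideanSpace ℝ (Fin d)))) := by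
      exact contMDiff_vectorSpace_iff_contDiff.2 contDiff_const
    refine (h2.comp h3.contMDiffOn (s := e.target) fun y hy => hy).congr fun y hy => ?_
    simp only [Function.comp_apply, tangentMapWithin]
    rw [mfderivWithin_of_isOpen e.open_target hy]
  have h4 : ContMDiffOn 𝓘(ℝ, EuclideanSpace ℝ (Fin d))
      ((𝓡 d).prod 𝓘(ℝ, EuclideanSpace ℝ (Fin d) →L[ℝ] ℝ)) ∞
      (fun y => Bundle.TotalSpace.mk' (EuclideanSpace ℝ (Fin d) →L[ℝ] ℝ)
        (E := fun x : M => TangentSpace (𝓡 d) x →L[ℝ] Bundle.Trivial M ℝ x) (e.symm y)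
        (α (e.symm y))) e.target := h.comp_contMDiffOn hsymm
  have h5 := ContMDiffOn.clm_bundle_apply (F₁ := EuclideanSpace ℝ (Fin d)) (F₂ := ℝ)
    (E₁ := fun x : M => TangentSpace (𝓡 d) x) (E₂ := Bundle.Trivial M ℝ) h4 h1
  intro y hy
  have h6 := (Bundle.contMDiffWithinAt_totalSpace.1 (h5 y hy)).2
  exact h6

theorem IsSmooth.contDiffOn_localRep [IsManifold (𝓡 d) ∞ M] {α : OneForm d M} (h : α.IsSmooth)
    (x : M) : ContDiffOn ℝ ∞ (α.localRep x) (chartAt (EuclideanSpace ℝ (Fin d)) x).target := by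
  rw [localRep_eq]
  exact (ContinuousAlternatingMap.ofSubsingletonLIE (𝕜 := ℝ) (E := EuclideanSpace ℝ (Fin d))
    (F := ℝ) (0 : Fin 1)).contDiff.comp_contDiffOn (h.contDiffOn_coordForm x)

theorem coordForm_mfderiv [IsManifold (𝓡 d) ∞ M] (α : OneForm d M) (x₀ : M) {x : M}
    (hx : x ∈ (chartAt (EuclideanSpace ℝ (Fin d)) x₀).source) (v : TangentSpace (𝓡 d) x) :
    α.coordForm x₀ (chartAt (EuclideanSpace ℝ (Fin d)) x₀ x)
      (mfderiv (𝓡 d) (𝓡 d) (chartAt (EuclideanSpace ℝ (Fin d)) x₀) x v) = α x v := by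
  have : IsManifold (𝓡 d) 1 M := IsManifold.of_le (n := ∞) (by norm_num)
  have h1 := (mdifferentiable_chart (I := 𝓡 d) x₀).symm_comp_deriv hx
  have h2 := (chartAt (EuclideanSpace ℝ (Fin d)) x₀).left_inv hx
  have h3 : mfderiv (𝓡 d) (𝓡 d) (chartAt (EuclideanSpace ℝ (Fin d)) x₀).symm
      (chartAt (EuclideanSpace ℝ (Fin d)) x₀ x)
      (mfderiv (𝓡 d) (𝓡 d) (chartAt (EuclideanSpace ℝ (Fin d)) x₀) x v) = v :=
    congrArg (fun L : EuclideanSpace ℝ (Fin d) →L[ℝ] EuclideanSpace ℝ (Fin d) => L v) h1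
  have h4 : ∀ u : EuclideanSpace ℝ (Fin d), (α ((chartAt (EuclideanSpace ℝ (Fin d)) x₀).symm
      (chartAt (EuclideanSpace ℝ (Fin d)) x₀ x)) : EuclideanSpace ℝ (Fin d) →L[ℝ] ℝ) u =
      (α x : EuclideanSpace ℝ (Fin d) →L[ℝ] ℝ) u := fun u =>
    congrArg (fun q => (α q : EuclideanSpace ℝ (Fin d) →L[ℝ] ℝ) u) h2
  exact (h4 _).trans (congrArg (α x : EuclideanSpace ℝ (Fin d) →L[ℝ] ℝ) h3)

/-- The exterior derivative commutes with pullbacks, and it may be computed in any preferred chart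
around the image point. -/
theorem IsSmooth.extD_pullback [IsManifold (𝓡 d) ∞ M] [IsManifold (𝓡 k) ∞ B] {α : OneForm d M}
    (h : α.IsSmooth) {f : B → M} {p : B} (hf : ContMDiffAt (𝓡 k) (𝓡 d) ∞ f p) {x₀ : M}
    (hp : f p ∈ (chartAt (EuclideanSpace ℝ (Fin d)) x₀).source) (v w : TangentSpace (𝓡 k) p) :
    (α.pullback f : OneForm k B).extD p v w =
      extDeriv (α.localRep x₀) (chartAt (EuclideanSpace ℝ (Fin d)) x₀ (f p))
        ![mfderiv (𝓡 d) (𝓡 d) (chartAt (EuclideanSpace ℝ (Fin d)) x₀) (f p)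
            (mfderiv (𝓡 k) (𝓡 d) f p v),
          mfderiv (𝓡 d) (𝓡 d) (chartAt (EuclideanSpace ℝ (Fin d)) x₀) (f p)
            (mfderiv (𝓡 k) (𝓡 d) f p w)] := by
  have : IsManifold (𝓡 d) 1 M := IsManifold.of_le (n := ∞) (by norm_num)
  have : IsManifold (𝓡 k) 1 B := IsManifold.of_le (n := ∞) (by norm_num)
  set c₀ := chartAt (EuclideanSpace ℝ (Fin d)) x₀ with hc₀
  set c := chartAt (EuclideanSpace ℝ (Fin k)) p with hc
  have hpc : p ∈ c.source := mem_chart_source _ _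
  have hyt : c p ∈ c.target := mem_chart_target _ _
  have hcp : c.symm (c p) = p := c.left_inv hpc
  set τ : EuclideanSpace ℝ (Fin k) → EuclideanSpace ℝ (Fin d) := c₀ ∘ f ∘ c.symm with hτ
  have hsymm : ∀ y ∈ c.target, ContMDiffAt (𝓡 k) (𝓡 k) ∞ c.symm y := fun y hy =>
    (contMDiffOn_chart_symm (I := 𝓡 k) (n := ∞) (x := p)).contMDiffAt (c.open_target.mem_nhds hy)
  have hchart : ∀ z ∈ c₀.source, ContMDiffAt (𝓡 d) (𝓡 d) ∞ c₀ z := fun z hz =>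
    (contMDiffOn_chart (I := 𝓡 d) (n := ∞) (x := x₀)).contMDiffAt (c₀.open_source.mem_nhds hz)
  have hcont : ContinuousAt c.symm (c p) := (hsymm _ hyt).continuousAt
  have hτsmooth : ContDiffAt ℝ ∞ τ (c p) := by
    rw [← contMDiffAt_iff_contDiffAt]
    refine ContMDiffAt.comp (I' := 𝓡 d) (c p) (hchart _ ?_)
      (ContMDiffAt.comp (I' := 𝓡 k) (c p) ?_ (hsymm _ hyt))
    · simpa only [Function.comp_apply, hcp] using hp
    · rw [hcp]; exact hf
  -- the chain rule for `τ` near the centre of the chart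
  have hchain : ∀ y ∈ c.target, f (c.symm y) ∈ c₀.source →
      MDifferentiableAt (𝓡 k) (𝓡 d) f (c.symm y) → ∀ u : EuclideanSpace ℝ (Fin k),
      fderiv ℝ τ y u = mfderiv (𝓡 d) (𝓡 d) c₀ (f (c.symm y))
        (mfderiv (𝓡 k) (𝓡 d) f (c.symm y) (mfderiv (𝓡 k) (𝓡 k) c.symm y u)) := by
    intro y hy hy' hfy u
    have hs : MDifferentiableAt (𝓡 k) (𝓡 k) c.symm y := (hsymm y hy).mdifferentiableAt (by simp)
    have e1 : mfderiv (𝓡 k) (𝓡 d) τ y = fderiv ℝ τ y := mfderiv_eq_fderiv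
    have e2 : mfderiv (𝓡 k) (𝓡 d) (f ∘ c.symm) y =
        (mfderiv (𝓡 k) (𝓡 d) f (c.symm y)).comp (mfderiv (𝓡 k) (𝓡 k) c.symm y) :=
      mfderiv_comp y hfy hs
    have e3 : mfderiv (𝓡 k) (𝓡 d) τ y = (mfderiv (𝓡 d) (𝓡 d) c₀ (f (c.symm y))).comp
        (mfderiv (𝓡 k) (𝓡 d) (f ∘ c.symm) y) :=
      mfderiv_comp y ((hchart _ hy').mdifferentiableAt (by simp))
        (MDifferentiableAt.comp y hfy hs)
    rw [← e1, e3, e2]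
    rfl
  have hev : (α.pullback f : OneForm k B).localRep p =ᶠ[𝓝 (c p)]
      fun y => (α.localRep x₀ (τ y)).compContinuousLinearMap (fderiv ℝ τ y) := by
    have hf1 : ∀ᶠ q in 𝓝 p, ContMDiffAt (𝓡 k) (𝓡 d) 1 f q :=
      (contMDiffAt_iff_contMDiffAt_nhds (by simp)).1 (hf.of_le (by norm_num))
    have hf2 : ∀ᶠ q in 𝓝 p, f q ∈ c₀.source :=
      hf.continuousAt.eventually (c₀.open_source.mem_nhds hp)
    have hcont' : Tendsto c.symm (𝓝 (c p)) (𝓝 p) := by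
      have := hcont.tendsto; rwa [hcp] at this
    filter_upwards [c.open_target.mem_nhds hyt, hcont'.eventually hf1, hcont'.eventually hf2]
      with y hy hy1 hy2
    ext u
    have e1 := hchain y hy hy2 (hy1.mdifferentiableAt (by simp)) (u 0)
    have e2 := α.coordForm_mfderiv x₀ hy2
      (mfderiv (𝓡 k) (𝓡 d) f (c.symm y) (mfderiv (𝓡 k) (𝓡 k) c.symm y (u 0)))
    rw [← hc₀, ← e1] at e2
    exact e2.symm
  have hdiff : DifferentiableAt ℝ (α.localRep x₀) (τ (c p)) := by
    have hm : τ (c p) ∈ c₀.target := by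
      simp only [hτ, Function.comp_apply, hcp]; exact c₀.map_source hp
    exact ((h.contDiffOn_localRep x₀).contDiffAt (c₀.open_target.mem_nhds hm)).differentiableAt
      (by simp)
  have hτp : τ (c p) = c₀ (f p) := by simp only [hτ, Function.comp_apply, hcp]
  have hD : ∀ u : TangentSpace (𝓡 k) p, fderiv ℝ τ (c p) (mfderiv (𝓡 k) (𝓡 k) c p u) =
      mfderiv (𝓡 d) (𝓡 d) c₀ (f p) (mfderiv (𝓡 k) (𝓡 d) f p u) := by
    intro u
    have e1 := hchain (c p) hyt (by rw [hcp]; exact hp)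
      (by rw [hcp]; exact hf.mdifferentiableAt (by simp)) (mfderiv (𝓡 k) (𝓡 k) c p u)
    have e2 : mfderiv (𝓡 k) (𝓡 k) c.symm (c p) (mfderiv (𝓡 k) (𝓡 k) c p u) = u :=
      congrArg (fun L : EuclideanSpace ℝ (Fin k) →L[ℝ] EuclideanSpace ℝ (Fin k) => L u)
        ((mdifferentiable_chart (I := 𝓡 k) p).symm_comp_deriv hpc)
    refine e1.trans ?_
    have e3 : ∀ q, q = p → ∀ u' : EuclideanSpace ℝ (Fin k), u' = u →
        (mfderiv (𝓡 d) (𝓡 d) c₀ (f q) (mfderiv (𝓡 k) (𝓡 d) f q u') : EuclideanSpace ℝ (Fin d)) =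
        mfderiv (𝓡 d) (𝓡 d) c₀ (f p) (mfderiv (𝓡 k) (𝓡 d) f p u) := by
      rintro q rfl u' rfl; rfl
    exact e3 _ hcp _ e2
  have hpull := extDeriv_pullback (r := ∞) hdiff hτsmooth
    (by rw [minSmoothness_of_isRCLikeNormedField]; norm_cast)
  have : (α.pullback f : OneForm k B).extD p v w =
      extDeriv ((α.pullback f : OneForm k B).localRep p) (c p)
        ![mfderiv (𝓡 k) (𝓡 k) c p v, mfderiv (𝓡 k) (𝓡 k) c p w] := rfl
  rw [this, hev.extDeriv_eq, hpull, hτp, ContinuousAlternatingMap.compContinuousLinearMap_apply]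
  congr 1
  funext i
  fin_cases i
  · exact hD v
  · exact hD w

/-- The exterior derivative at `x` may be computed in any preferred chart around `x`. -/
theorem IsSmooth.extD_eq_extDeriv [IsManifold (𝓡 d) ∞ M] {α : OneForm d M} (h : α.IsSmooth)
    {x₀ x : M} (hx : x ∈ (chartAt (EuclideanSpace ℝ (Fin d)) x₀).source)
    (v w : TangentSpace (𝓡 d) x) :
    α.extD x v w = extDeriv (α.localRep x₀) (chartAt (EuclideanSpace ℝ (Fin d)) x₀ x)
        ![mfderiv (𝓡 d) (𝓡 d) (chartAt (EuclideanSpace ℝ (Fin d)) x₀) x v,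
          mfderiv (𝓡 d) (𝓡 d) (chartAt (EuclideanSpace ℝ (Fin d)) x₀) x w] := by
  have hid : (α.pullback (id : M → M) : OneForm d M) = α := by
    funext q
    ext u
    simp only [pullback, mfderiv_id]
    rfl
  have := h.extD_pullback (f := (id : M → M)) (p := x) contMDiffAt_id hx v w
  rw [hid, mfderiv_id] at this
  exact this

theorem IsSmooth.extD_pullback_apply [IsManifold (𝓡 d) ∞ M] [IsManifold (𝓡 k) ∞ B] {α : OneForm d M}
    (h : α.IsSmooth) {f : B → M} {p : B} (hf : ContMDiffAt (𝓡 k) (𝓡 d) ∞ f p)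
    (v w : TangentSpace (𝓡 k) p) : (α.pullback f : OneForm k B).extD p v w =
      α.extD (f p) (mfderiv (𝓡 k) (𝓡 d) f p v) (mfderiv (𝓡 k) (𝓡 d) f p w) :=
  h.extD_pullback hf (mem_chart_source _ _) v w

end OneForm

/-! ### The contact bilinear form in coordinates -/

namespace OneForm

variable {d k : ℕ} {M : Type*} [TopologicalSpace M] [ChartedSpace (EuclideanSpace ℝ (Fin d)) M]

/-- The exterior derivative of `α` in the preferred chart at `x`, as a bilinear form. -/
def coordD (α : OneForm d M) (x : M) (y : EuclideanSpace ℝ (Fin d)) :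
    EuclideanSpace ℝ (Fin d) →L[ℝ] EuclideanSpace ℝ (Fin d) →L[ℝ] ℝ :=
  fderiv ℝ (α.coordForm x) y - (fderiv ℝ (α.coordForm x) y).flip

/-- The bilinear form `dα + α ⊗ α` in the preferred chart at `x`. -/
def coordContact (α : OneForm d M) (x : M) (y : EuclideanSpace ℝ (Fin d)) :
    EuclideanSpace ℝ (Fin d) →L[ℝ] EuclideanSpace ℝ (Fin d) →L[ℝ] ℝ :=
  α.coordD x y + (α.coordForm x y).smulRight (α.coordForm x y)

theorem extDeriv_localRep {α : OneForm d M} {x : M} {y : EuclideanSpace ℝ (Fin d)}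
    (h : DifferentiableAt ℝ (α.coordForm x) y) (v w : EuclideanSpace ℝ (Fin d)) :
    extDeriv (α.localRep x) y ![v, w] = α.coordD x y v w := by
  have h' : DifferentiableAt ℝ (α.localRep x) y :=
    (ContinuousAlternatingMap.ofSubsingletonLIE (𝕜 := ℝ) (E := EuclideanSpace ℝ (Fin d))
      (F := ℝ) (0 : Fin 1)).differentiable.differentiableAt.comp y h
  have hv : ∀ u u' : EuclideanSpace ℝ (Fin d), fderiv ℝ (fun y => α.coordForm x y u) y u' =
      fderiv ℝ (α.coordForm x) y u' u := by
    intro u u'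
    rw [fderiv_clm_apply h (differentiableAt_const u)]
    simp
  rw [extDeriv_apply h', Fin.sum_univ_two]
  have e1 : (fun y => α.localRep x y (Fin.removeNth 0 ![v, w])) = fun y => α.coordForm x y w := rfl
  have e2 : (fun y => α.localRep x y (Fin.removeNth 1 ![v, w])) = fun y => α.coordForm x y v := rfl
  rw [e1, e2, hv, hv]
  simp [coordD, sub_eq_add_neg]

/-- The exterior derivative of `α` at `x` as a bilinear form on the tangent space. -/
def extDBilin (α : OneForm d M) (x : M) :
    EuclideanSpace ℝ (Fin d) →ₗ[ℝ] EuclideanSpace ℝ (Fin d) →ₗ[ℝ] ℝ :=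
  ((α.coordD x (chartAt (EuclideanSpace ℝ (Fin d)) x x)).toLinearMap₁₂).compl₁₂
    (mfderiv (𝓡 d) (𝓡 d) (chartAt (EuclideanSpace ℝ (Fin d)) x) x).toLinearMap
    (mfderiv (𝓡 d) (𝓡 d) (chartAt (EuclideanSpace ℝ (Fin d)) x) x).toLinearMap

/-- The value of `α` at `x` as a continuous linear form on the model space. -/
def toCLM (α : OneForm d M) (x : M) : EuclideanSpace ℝ (Fin d) →L[ℝ] ℝ := α x

/-- The value of `α` at `x` as a linear form on the model space. -/
def toLin (α : OneForm d M) (x : M) : EuclideanSpace ℝ (Fin d) →ₗ[ℝ] ℝ := (α.toCLM x).toLinearMap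

theorem extDBilin_antisymm (α : OneForm d M) (x : M) (v w : EuclideanSpace ℝ (Fin d)) :
    α.extDBilin x v w = -α.extDBilin x w v := by
  change α.coordD x _ _ _ = -α.coordD x _ _ _
  simp only [coordD, sub_apply, ContinuousLinearMap.flip_apply, neg_sub]

theorem extDBilin_self (α : OneForm d M) (x : M) (v : EuclideanSpace ℝ (Fin d)) :
    α.extDBilin x v v = 0 := by
  linarith [α.extDBilin_antisymm x v v]

theorem IsReeb.toLin_apply {α : OneForm d M} {R : M → EuclideanSpace ℝ (Fin d)} (hR : α.IsReeb R)
    (x : M) : α.toLin x (R x) = 1 := (hR x).1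

variable [IsManifold (𝓡 d) ∞ M]

theorem IsSmooth.extD_eq_coordD {α : OneForm d M} (h : α.IsSmooth) {x₀ x : M}
    (hx : x ∈ (chartAt (EuclideanSpace ℝ (Fin d)) x₀).source) (v w : TangentSpace (𝓡 d) x) :
    α.extD x v w = α.coordD x₀ (chartAt (EuclideanSpace ℝ (Fin d)) x₀ x)
      (mfderiv (𝓡 d) (𝓡 d) (chartAt (EuclideanSpace ℝ (Fin d)) x₀) x v)
      (mfderiv (𝓡 d) (𝓡 d) (chartAt (EuclideanSpace ℝ (Fin d)) x₀) x w) := by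
  refine (h.extD_eq_extDeriv hx v w).trans (extDeriv_localRep ?_ _ _)
  exact ((h.contDiffOn_coordForm x₀).contDiffAt
    ((chartAt (EuclideanSpace ℝ (Fin d)) x₀).open_target.mem_nhds
      ((chartAt (EuclideanSpace ℝ (Fin d)) x₀).map_source hx))).differentiableAt (by simp)

theorem IsSmooth.contDiffAt_coordContact {α : OneForm d M} (h : α.IsSmooth) {x₀ : M}
    {y : EuclideanSpace ℝ (Fin d)} (hy : y ∈ (chartAt (EuclideanSpace ℝ (Fin d)) x₀).target) :
    ContDiffAt ℝ ∞ (α.coordContact x₀) y := by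
  have hopen := (chartAt (EuclideanSpace ℝ (Fin d)) x₀).open_target
  have h1 := h.contDiffOn_coordForm x₀
  have h2 : ContDiffOn ℝ ∞ (fderiv ℝ (α.coordForm x₀))
      (chartAt (EuclideanSpace ℝ (Fin d)) x₀).target := h1.fderiv_of_isOpen hopen (by simp)
  have h3 : ContDiffOn ℝ ∞ (fun y => (fderiv ℝ (α.coordForm x₀) y).flip)
      (chartAt (EuclideanSpace ℝ (Fin d)) x₀).target :=
    contDiffOn_clm_apply.2 fun v => contDiffOn_clm_apply.2 fun w =>
      (h2.clm_apply contDiffOn_const).clm_apply contDiffOn_const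
  exact ((h2.sub h3).add (h1.smulRight h1)).contDiffAt (hopen.mem_nhds hy)

theorem IsSmooth.extDBilin_apply {α : OneForm d M} (h : α.IsSmooth) (x : M)
    (v w : EuclideanSpace ℝ (Fin d)) : α.extDBilin x v w = α.extD x v w :=
  (h.extD_eq_coordD (mem_chart_source _ x) v w).symm

theorem IsSmooth.wedgePow_eq {α : OneForm d M} (h : α.IsSmooth) (n : ℕ) (x : M)
    (v : Fin (2 * n + 1) → EuclideanSpace ℝ (Fin d)) :
    α.wedgePow n x v = (1 / 2 ^ n) * wedgeSum n (α.toLin x) (fun v w => α.extDBilin x v w) v := by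
  have : (fun v w => α.extDBilin x v w) = fun v w => α.extD x v w := by
    funext v w; exact h.extDBilin_apply x v w
  rw [this]
  rfl

/-- At each point the bilinear form `dα + α ⊗ α` of a contact form is nondegenerate. -/
theorem IsContact.existsUnique {n : ℕ} {α : OneForm d M} (h : α.IsContact n) (x : M)
    (β : EuclideanSpace ℝ (Fin d) →ₗ[ℝ] ℝ) : ∃! v : EuclideanSpace ℝ (Fin d),
      ∀ w, α.extDBilin x v w + α.toLin x v * α.toLin x w = β w := by
  obtain ⟨v, hv⟩ : ∃ v : Fin (2 * n + 1) → EuclideanSpace ℝ (Fin d), α.wedgePow n x v ≠ 0 :=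
    h.ne_zero x
  rw [h.smooth.wedgePow_eq] at hv
  have hv' := right_ne_zero_of_mul hv
  have hrank : Module.finrank ℝ (EuclideanSpace ℝ (Fin d)) = 2 * n + 1 := by
    rw [finrank_euclideanSpace_fin, h.dim_eq]
  have hiff : ∀ v, (∀ w, α.extDBilin x v w + α.toLin x v * α.toLin x w = β w) ↔
      contactBilin (α.toLin x) (α.extDBilin x) v = β := by
    intro v
    rw [LinearMap.ext_iff]
    simp only [contactBilin_apply]
  simp only [hiff]
  exact Function.Bijective.existsUnique
    ⟨contactBilin_injective hrank (α.extDBilin_antisymm x) hv',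
      contactBilin_surjective hrank (α.extDBilin_antisymm x) hv'⟩ β

/-- A vector field `Y` for which `i_Y dα + α(Y) α` has a smooth expression `b` in the preferred chart at
`x₀` has a smooth expression `Z` in that chart, obtained by inverting `dα + α ⊗ α`. -/
theorem IsContact.eventually_coord_eq {n : ℕ} {α : OneForm d M} (h : α.IsContact n) (x₀ : M)
    {Y : ∀ x : M, TangentSpace (𝓡 d) x}
    {b : EuclideanSpace ℝ (Fin d) → EuclideanSpace ℝ (Fin d) →L[ℝ] ℝ}
    (hb : ContDiffAt ℝ ∞ b (chartAt (EuclideanSpace ℝ (Fin d)) x₀ x₀))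
    (hY : ∀ᶠ x in 𝓝 x₀, ∀ w : EuclideanSpace ℝ (Fin d),
      α.extDBilin x (Y x) w + α.toLin x (Y x) * α.toLin x w =
        b (chartAt (EuclideanSpace ℝ (Fin d)) x₀ x)
          (mfderiv (𝓡 d) (𝓡 d) (chartAt (EuclideanSpace ℝ (Fin d)) x₀) x w)) :
    ∃ Z : EuclideanSpace ℝ (Fin d) → EuclideanSpace ℝ (Fin d),
      ContDiffAt ℝ ∞ Z (chartAt (EuclideanSpace ℝ (Fin d)) x₀ x₀) ∧
      ∀ᶠ x in 𝓝 x₀, mfderiv (𝓡 d) (𝓡 d) (chartAt (EuclideanSpace ℝ (Fin d)) x₀) x (Y x) =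
        Z (chartAt (EuclideanSpace ℝ (Fin d)) x₀ x) := by
  have : IsManifold (𝓡 d) 1 M := IsManifold.of_le (n := ∞) (by norm_num)
  set c := chartAt (EuclideanSpace ℝ (Fin d)) x₀ with hc
  have hxs : x₀ ∈ c.source := mem_chart_source _ _
  have hformula : ∀ x ∈ c.source, ∀ v w : EuclideanSpace ℝ (Fin d),
      α.coordContact x₀ (c x) (mfderiv (𝓡 d) (𝓡 d) c x v) (mfderiv (𝓡 d) (𝓡 d) c x w) =
      α.extDBilin x v w + α.toLin x v * α.toLin x w := by
    intro x hx v w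
    have e1 := h.smooth.extD_eq_coordD hx v w
    have e2 := α.coordForm_mfderiv x₀ hx v
    have e3 := α.coordForm_mfderiv x₀ hx w
    rw [← hc] at e1 e2 e3
    rw [h.smooth.extDBilin_apply, e1]
    change α.coordD x₀ (c x) _ _ + α.coordForm x₀ (c x) _ * α.coordForm x₀ (c x) _ = _
    rw [e2, e3]
    rfl
  have hinv : ∀ x ∈ c.source, ∃ e : EuclideanSpace ℝ (Fin d) ≃L[ℝ]
      (EuclideanSpace ℝ (Fin d) →L[ℝ] ℝ), (e : EuclideanSpace ℝ (Fin d) →L[ℝ] _) =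
        α.coordContact x₀ (c x) := by
    intro x hx
    have hsurj : Function.Surjective (mfderiv (𝓡 d) (𝓡 d) c x) :=
      (mdifferentiable_chart (I := 𝓡 d) x₀).mfderiv_surjective hx
    have hinj : Function.Injective (α.coordContact x₀ (c x)).toLinearMap := by
      rw [injective_iff_map_eq_zero]
      intro v hv
      obtain ⟨v', hv'⟩ : ∃ v' : EuclideanSpace ℝ (Fin d), mfderiv (𝓡 d) (𝓡 d) c x v' = v := hsurj v
      have h0 : v' = 0 := by
        refine (h.existsUnique x 0).unique (fun w => ?_) (fun w => by simp)
        rw [← hformula x hx, hv']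
        exact congrArg (fun L : EuclideanSpace ℝ (Fin d) →L[ℝ] ℝ =>
          L (mfderiv (𝓡 d) (𝓡 d) c x w)) hv
      rw [← hv', h0]
      exact map_zero (mfderiv (𝓡 d) (𝓡 d) c x)
    have hrank : Module.finrank ℝ (EuclideanSpace ℝ (Fin d)) =
        Module.finrank ℝ (EuclideanSpace ℝ (Fin d) →L[ℝ] ℝ) := by
      rw [← (LinearMap.toContinuousLinearMap (𝕜 := ℝ) (E := EuclideanSpace ℝ (Fin d))
        (F' := ℝ)).finrank_eq]
      exact (Subspace.dual_finrank_eq (K := ℝ) (V := EuclideanSpace ℝ (Fin d))).symm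
    refine ⟨(LinearEquiv.ofInjectiveOfFinrankEq _ hinj hrank).toContinuousLinearEquiv, ?_⟩
    ext v w
    rfl
  refine ⟨fun y => (α.coordContact x₀ y).inverse (b y), ?_, ?_⟩
  · obtain ⟨e, he⟩ := hinv x₀ hxs
    have h1 : ContDiffAt ℝ ∞ (fun y => (α.coordContact x₀ y).inverse) (c x₀) := by
      have h2 := contDiffAt_map_inverse (n := ∞) e
      rw [he] at h2
      exact h2.comp (c x₀) (h.smooth.contDiffAt_coordContact (c.map_source hxs))
    exact h1.clm_apply hb
  · filter_upwards [hY, c.open_source.mem_nhds hxs] with x hx hxc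
    obtain ⟨e, he⟩ := hinv x hxc
    have hsurj : Function.Surjective (mfderiv (𝓡 d) (𝓡 d) c x) :=
      (mdifferentiable_chart (I := 𝓡 d) x₀).mfderiv_surjective hxc
    have h1 : α.coordContact x₀ (c x) (mfderiv (𝓡 d) (𝓡 d) c x (Y x)) = b (c x) := by
      ext w
      obtain ⟨w', hw'⟩ : ∃ w' : EuclideanSpace ℝ (Fin d), mfderiv (𝓡 d) (𝓡 d) c x w' = w := hsurj w
      rw [← hw', ← hx w']
      exact hformula x hxc _ _
    have h2 : (α.coordContact x₀ (c x)).inverse (b (c x)) =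
        (mfderiv (𝓡 d) (𝓡 d) c x (Y x) : EuclideanSpace ℝ (Fin d)) := by
      rw [← h1, ← he, ContinuousLinearMap.inverse_equiv]
      exact e.symm_apply_apply _
    exact h2.symm

/-- A vector field is smooth at a point if its expression in the preferred chart at that point is
smooth. -/
theorem _root_.contMDiffAt_vectorField_of_coord {x₀ : M}
    {Y : ∀ x : M, TangentSpace (𝓡 d) x} {Z : EuclideanSpace ℝ (Fin d) → EuclideanSpace ℝ (Fin d)}
    (hZ : ContDiffAt ℝ ∞ Z (chartAt (EuclideanSpace ℝ (Fin d)) x₀ x₀))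
    (hY : ∀ᶠ x in 𝓝 x₀, mfderiv (𝓡 d) (𝓡 d) (chartAt (EuclideanSpace ℝ (Fin d)) x₀) x (Y x) =
        Z (chartAt (EuclideanSpace ℝ (Fin d)) x₀ x)) :
    ContMDiffAt (𝓡 d) (𝓡 d).tangent ∞ (fun x => (⟨x, Y x⟩ : TangentBundle (𝓡 d) M)) x₀ := by
  have : IsManifold (𝓡 d) 1 M := IsManifold.of_le (n := ∞) (by norm_num)
  set c := chartAt (EuclideanSpace ℝ (Fin d)) x₀ with hc
  have hxs : x₀ ∈ c.source := mem_chart_source _ _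
  have hinv : ∀ x ∈ c.source, (mfderiv (𝓡 d) (𝓡 d) c x).IsInvertible := fun x hx =>
    ⟨(mdifferentiable_chart (I := 𝓡 d) x₀).mfderiv hx, rfl⟩
  have h1 : ContMDiffAt (𝓡 d) (𝓡 d).tangent ∞
      (fun y => (⟨y, Z y⟩ : TangentBundle (𝓡 d) (EuclideanSpace ℝ (Fin d)))) (c x₀) :=
    contMDiffAt_vectorSpace_iff_contDiffAt.2 hZ
  have hcs : ContMDiffAt (𝓡 d) (𝓡 d) ∞ c x₀ :=
    (contMDiffOn_chart (I := 𝓡 d) (n := ∞) (x := x₀)).contMDiffAt (c.open_source.mem_nhds hxs)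
  have h2 := ContMDiffAt.mpullback_vectorField_preimage h1 hcs (hinv x₀ hxs) (by simp)
  refine h2.congr_of_eventuallyEq ?_
  filter_upwards [hY, c.open_source.mem_nhds hxs] with x hx hxc
  congr 1
  have h3 : VectorField.mpullback (𝓡 d) (𝓡 d) c Z x =
      (mfderiv (𝓡 d) (𝓡 d) c x).inverse (Z (c x)) := rfl
  rw [h3, ← hx]
  exact ((hinv x hxc).inverse_apply_eq.2 rfl).symm

end OneForm

/-! ### Charts adapted to functions -/

section AdaptedCharts

variable {d : ℕ} {M : Type*} [TopologicalSpace M] [ChartedSpace (EuclideanSpace ℝ (Fin d)) M]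

/-- The differential at `x` of a real function on `M`, as a linear form on the model space. -/
def realDeriv (η : M → ℝ) (x : M) : EuclideanSpace ℝ (Fin d) →L[ℝ] ℝ :=
  mfderiv (𝓡 d) 𝓘(ℝ, ℝ) η x

/-- The differential at `x` of a chart of `M`, as an endomorphism of the model space. -/
def chartDeriv (e : OpenPartialHomeomorph M (EuclideanSpace ℝ (Fin d))) (x : M) :
    EuclideanSpace ℝ (Fin d) →L[ℝ] EuclideanSpace ℝ (Fin d) :=
  mfderiv (𝓡 d) (𝓡 d) e x

theorem realDeriv_congr {η η' : M → ℝ} {x : M} (h : η =ᶠ[𝓝 x] η') :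
    (realDeriv η x : EuclideanSpace ℝ (Fin d) →L[ℝ] ℝ) = realDeriv η' x :=
  h.mfderiv_eq

variable {e : OpenPartialHomeomorph M (EuclideanSpace ℝ (Fin d))}

theorem mdifferentiable_of_mem_maximalAtlas (he : e ∈ IsManifold.maximalAtlas (𝓡 d) ∞ M) :
    e.MDifferentiable (𝓡 d) (𝓡 d) :=
  ⟨(contMDiffOn_of_mem_maximalAtlas he).mdifferentiableOn (by simp),
    (contMDiffOn_symm_of_mem_maximalAtlas he).mdifferentiableOn (by simp)⟩

/-- The chain rule for the coordinate expression of a function. -/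
theorem realDeriv_eq_fderiv (he : e ∈ IsManifold.maximalAtlas (𝓡 d) ∞ M) {x : M}
    (hx : x ∈ e.source) {η : M → ℝ} (hη : ContMDiffAt (𝓡 d) 𝓘(ℝ, ℝ) ∞ η x)
    (v : EuclideanSpace ℝ (Fin d)) :
    realDeriv η x v = fderiv ℝ (η ∘ e.symm) (e x) (chartDeriv e x v) := by
  have hd := mdifferentiable_of_mem_maximalAtlas he
  have h1 : (η ∘ e.symm) ∘ e =ᶠ[𝓝 x] η := by
    filter_upwards [e.open_source.mem_nhds hx] with y hy
    simp only [Function.comp_apply, e.left_inv hy]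
  have h2 : MDifferentiableAt (𝓡 d) 𝓘(ℝ, ℝ) (η ∘ e.symm) (e x) := by
    refine MDifferentiableAt.comp (I' := 𝓡 d) (e x) ?_ (hd.mdifferentiableAt_symm (e.map_source hx))
    rw [e.left_inv hx]
    exact hη.mdifferentiableAt (by simp)
  have h3 : mfderiv (𝓡 d) 𝓘(ℝ, ℝ) ((η ∘ e.symm) ∘ e) x =
      (mfderiv (𝓡 d) 𝓘(ℝ, ℝ) (η ∘ e.symm) (e x)).comp (mfderiv (𝓡 d) (𝓡 d) e x) :=
    mfderiv_comp x h2 (hd.mdifferentiableAt hx)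
  have h4 : mfderiv (𝓡 d) 𝓘(ℝ, ℝ) (η ∘ e.symm) (e x) = fderiv ℝ (η ∘ e.symm) (e x) :=
    mfderiv_eq_fderiv
  rw [← realDeriv_congr h1, realDeriv, h3, h4]
  rfl

theorem realDeriv_of_coord_eq (he : e ∈ IsManifold.maximalAtlas (𝓡 d) ∞ M) {x : M}
    (hx : x ∈ e.source) {η : M → ℝ} (hη : ContMDiffAt (𝓡 d) 𝓘(ℝ, ℝ) ∞ η x) {i : Fin d}
    (h : ∀ y ∈ e.source, e y i = η y) (v : EuclideanSpace ℝ (Fin d)) :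
    realDeriv η x v = chartDeriv e x v i := by
  have h1 : η ∘ e.symm =ᶠ[𝓝 (e x)] (EuclideanSpace.proj i : EuclideanSpace ℝ (Fin d) →L[ℝ] ℝ) := by
    filter_upwards [e.open_target.mem_nhds (e.map_source hx)] with y hy
    rw [Function.comp_apply, ← h _ (e.map_target hy), e.right_inv hy]
    rfl
  rw [realDeriv_eq_fderiv he hx hη, h1.fderiv_eq, ContinuousLinearMap.fderiv]
  rfl

theorem realDeriv_eq_zero_of_isVelocityInto {S : Set M} {x : M} {η : M → ℝ}
    (hη : ContMDiffAt (𝓡 d) 𝓘(ℝ, ℝ) ∞ η x) (hηx : η x = 0) (h0 : ∀ᶠ y in 𝓝 x, y ∈ S → η y = 0)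
    {v : EuclideanSpace ℝ (Fin d)} (hv : IsVelocityInto (d := d) S x v) : realDeriv η x v = 0 := by
  obtain ⟨γ, hγ0, hγ, hγS, hγv⟩ := hv
  subst hγ0
  have hdη : MDifferentiableAt (𝓡 d) 𝓘(ℝ, ℝ) η (γ 0) := hη.mdifferentiableAt (by simp)
  have hdγ : MDifferentiableAt 𝓘(ℝ, ℝ) (𝓡 d) γ 0 := hγ.mdifferentiableAt (by simp)
  have h1 : mfderiv 𝓘(ℝ, ℝ) 𝓘(ℝ, ℝ) (η ∘ γ) 0 =
      (mfderiv (𝓡 d) 𝓘(ℝ, ℝ) η (γ 0)).comp (mfderiv 𝓘(ℝ, ℝ) (𝓡 d) γ 0) :=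
    mfderiv_comp 0 hdη hdγ
  have h2 : DifferentiableAt ℝ (η ∘ γ) 0 :=
    mdifferentiableAt_iff_differentiableAt.1 (hdη.comp 0 hdγ)
  have h3 : mfderiv 𝓘(ℝ, ℝ) 𝓘(ℝ, ℝ) (η ∘ γ) 0 = fderiv ℝ (η ∘ γ) 0 := mfderiv_eq_fderiv
  have h4 : HasDerivWithinAt (η ∘ γ) (deriv (η ∘ γ) 0) (Ici 0) 0 :=
    h2.hasDerivAt.hasDerivWithinAt
  have h5 : HasDerivWithinAt (η ∘ γ) 0 (Ici 0) 0 := by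
    refine (hasDerivWithinAt_const (0 : ℝ) (Ici 0) (0 : ℝ)).congr_of_eventuallyEq ?_ hηx
    filter_upwards [hγS, nhdsWithin_le_nhds (hγ.continuousAt.eventually h0)] with s hs hs'
    exact hs' hs
  have h6 : deriv (η ∘ γ) 0 = 0 := (uniqueDiffOn_Ici (0 : ℝ) 0 self_mem_Ici).eq_deriv _ h4 h5
  have h7 : fderiv ℝ (η ∘ γ) 0 1 = 0 := by rw [fderiv_apply_one_eq_deriv, h6]
  rw [← h3, h1] at h7
  rw [← hγv]
  exact h7

/-- The tangent space of a level set is contained in the kernel of the differential. -/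
theorem realDeriv_eq_zero_of_mem_tangentTo {S : Set M} {x : M} {η : M → ℝ}
    (hη : ContMDiffAt (𝓡 d) 𝓘(ℝ, ℝ) ∞ η x) (hηx : η x = 0) (h0 : ∀ᶠ y in 𝓝 x, y ∈ S → η y = 0)
    {v : EuclideanSpace ℝ (Fin d)} (hv : v ∈ tangentTo (d := d) S x) : realDeriv η x v = 0 := by
  have : tangentTo (d := d) S x ≤ LinearMap.ker (realDeriv η x).toLinearMap :=
    Submodule.span_le.2 fun v hv => realDeriv_eq_zero_of_isVelocityInto hη hηx h0 hv
  exact this hv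

variable [IsManifold (𝓡 d) ∞ M]

/-- The inverse function theorem: a map with invertible derivative, composed with a chart, is a
chart on a smaller neighbourhood. -/
theorem exists_chart_eq_comp (he : e ∈ IsManifold.maximalAtlas (𝓡 d) ∞ M) {x : M}
    (hx : x ∈ e.source) {Φ : EuclideanSpace ℝ (Fin d) → EuclideanSpace ℝ (Fin d)} {W : Set (EuclideanSpace ℝ (Fin d))}
    (hW : IsOpen W) (hxW : e x ∈ W) (hΦ : ContDiffOn ℝ ∞ Φ W)
    (hinj : Function.Injective (fderiv ℝ Φ (e x))) :
    ∃ e' ∈ IsManifold.maximalAtlas (𝓡 d) ∞ M, x ∈ e'.source ∧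
      e'.source ⊆ e.source ∩ e ⁻¹' W ∧ ∀ y, e' y = Φ (e y) := by
  have hΦx : ContDiffAt ℝ ∞ Φ (e x) := hΦ.contDiffAt (hW.mem_nhds hxW)
  let A : EuclideanSpace ℝ (Fin d) ≃L[ℝ] EuclideanSpace ℝ (Fin d) :=
    (LinearEquiv.ofInjectiveEndo (fderiv ℝ Φ (e x)).toLinearMap hinj).toContinuousLinearEquiv
  have hA : (A : EuclideanSpace ℝ (Fin d) →L[ℝ] EuclideanSpace ℝ (Fin d)) = fderiv ℝ Φ (e x) := by
    ext v; rfl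
  have hA' : HasFDerivAt Φ (A : EuclideanSpace ℝ (Fin d) →L[ℝ] EuclideanSpace ℝ (Fin d)) (e x) := by
    rw [hA]; exact (hΦx.differentiableAt (by simp)).hasFDerivAt
  let g₀ := hΦx.toOpenPartialHomeomorph Φ hA' (by simp)
  have hg₀ : ∀ y, g₀ y = Φ y := fun y => by
    rw [ContDiffAt.toOpenPartialHomeomorph_coe]
  have hg₀x : e x ∈ g₀.source := ContDiffAt.mem_toOpenPartialHomeomorph_source hΦx hA' (by simp)
  -- near `e x` the derivative stays invertible
  have hfd : ContinuousOn (fderiv ℝ Φ) W :=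
    (hΦ.fderiv_of_isOpen (m := 0) hW (by simp)).continuousOn
  set O : Set (EuclideanSpace ℝ (Fin d)) := W ∩ fderiv ℝ Φ ⁻¹' (range
    (ContinuousLinearEquiv.toContinuousLinearMap : (EuclideanSpace ℝ (Fin d) ≃L[ℝ] _) → _)) with hO
  have hOopen : IsOpen O := hfd.isOpen_inter_preimage hW ContinuousLinearEquiv.isOpen
  have hxO : e x ∈ O := ⟨hxW, A, hA⟩
  let g := g₀.restrOpen O hOopen
  have hgs : g.source = g₀.source ∩ O := g₀.restrOpen_source O hOopen
  have hgΦ : ContDiffOn ℝ ∞ g g.source := by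
    refine (hΦ.mono fun y hy => ?_).congr fun y _ => hg₀ y
    rw [hgs] at hy
    exact hy.2.1
  have hgsymm : ContDiffOn ℝ ∞ g.symm g.target := by
    intro y hy
    have hs : g.symm y ∈ g₀.source ∩ O := by rw [← hgs]; exact g.map_target hy
    obtain ⟨A', hA'⟩ := hs.2.2
    have hat : ContDiffAt ℝ ∞ Φ (g.symm y) := hΦ.contDiffAt (hW.mem_nhds hs.2.1)
    have hgΦ' : (g : EuclideanSpace ℝ (Fin d) → EuclideanSpace ℝ (Fin d)) = Φ := funext hg₀
    refine (g.contDiffAt_symm (f₀' := A') hy ?_ ?_).contDiffWithinAt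
    · rw [hgΦ', hA']; exact (hat.differentiableAt (by simp)).hasFDerivAt
    · rw [hgΦ']; exact hat
  refine ⟨e.trans g, ?_, ?_, ?_, fun y => hg₀ _⟩
  · refine OpenPartialHomeomorph.mem_maximalAtlas_of_contMDiffOn _ ?_ ?_
    · have h1 : ContMDiffOn (𝓡 d) (𝓡 d) ∞ g g.source := contMDiffOn_iff_contDiffOn.2 hgΦ
      refine h1.comp ((contMDiffOn_of_mem_maximalAtlas he).mono fun y hy => ?_) fun y hy => ?_
      · rw [OpenPartialHomeomorph.trans_source] at hy; exact hy.1
      · rw [OpenPartialHomeomorph.trans_source] at hy; exact hy.2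
    · have h1 : ContMDiffOn (𝓡 d) (𝓡 d) ∞ g.symm g.target := contMDiffOn_iff_contDiffOn.2 hgsymm
      refine (contMDiffOn_symm_of_mem_maximalAtlas he).comp (h1.mono fun y hy => ?_) fun y hy => ?_
      · rw [OpenPartialHomeomorph.trans_target] at hy; exact hy.1
      · rw [OpenPartialHomeomorph.trans_target] at hy; exact hy.2
  · rw [OpenPartialHomeomorph.trans_source]
    refine ⟨hx, ?_⟩
    rw [mem_preimage, hgs]
    exact ⟨hg₀x, hxO⟩
  · intro y hy
    rw [OpenPartialHomeomorph.trans_source, mem_inter_iff, mem_preimage, hgs] at hy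
    exact ⟨hy.1, hy.2.2.1⟩

/-- A coordinate of a chart can be replaced by a function whose derivative in the direction of that
coordinate does not vanish. -/
theorem exists_chart_replace_coord (he : e ∈ IsManifold.maximalAtlas (𝓡 d) ∞ M) {x : M}
    (hx : x ∈ e.source) {O : Set M} (hO : IsOpen O) (hxO : x ∈ O) {η : M → ℝ}
    (hη : ContMDiffOn (𝓡 d) 𝓘(ℝ, ℝ) ∞ η O) {j : Fin d}
    (hj : fderiv ℝ (η ∘ e.symm) (e x) (EuclideanSpace.single j 1) ≠ 0) :
    ∃ e' ∈ IsManifold.maximalAtlas (𝓡 d) ∞ M, x ∈ e'.source ∧ e'.source ⊆ e.source ∩ O ∧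
      (∀ y ∈ e'.source, e' y j = η y) ∧ ∀ k, k ≠ j → ∀ y, e' y k = e y k := by
  set W : Set (EuclideanSpace ℝ (Fin d)) := e.target ∩ e.symm ⁻¹' O with hW
  have hWopen : IsOpen W := e.isOpen_inter_preimage_symm hO
  have hxW : e x ∈ W := ⟨e.map_source hx, by rw [mem_preimage, e.left_inv hx]; exact hxO⟩
  have hh : ContDiffOn ℝ ∞ (η ∘ e.symm) W := by
    have : ContMDiffOn (𝓡 d) 𝓘(ℝ, ℝ) ∞ (η ∘ e.symm) W :=
      hη.comp ((contMDiffOn_symm_of_mem_maximalAtlas he).mono inter_subset_left) fun y hy => hy.2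
    exact contMDiffOn_iff_contDiffOn.1 this
  set Φ : EuclideanSpace ℝ (Fin d) → EuclideanSpace ℝ (Fin d) := fun z =>
    z + ((η ∘ e.symm) z - (EuclideanSpace.proj j : EuclideanSpace ℝ (Fin d) →L[ℝ] ℝ) z) •
      EuclideanSpace.single j (1 : ℝ) with hΦdef
  have hΦ : ContDiffOn ℝ ∞ Φ W := contDiffOn_id.add
    ((hh.sub (ContinuousLinearMap.contDiff _).contDiffOn).smul contDiffOn_const)
  have hfd : HasFDerivAt Φ (ContinuousLinearMap.id ℝ _ + (fderiv ℝ (η ∘ e.symm) (e x) -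
      (EuclideanSpace.proj j : EuclideanSpace ℝ (Fin d) →L[ℝ] ℝ)).smulRight
        (EuclideanSpace.single j (1 : ℝ))) (e x) := by
    refine (hasFDerivAt_id _).add (HasFDerivAt.smul_const ?_ _)
    exact ((hh.contDiffAt (hWopen.mem_nhds hxW)).differentiableAt (by simp)).hasFDerivAt.sub
      (ContinuousLinearMap.hasFDerivAt _)
  have hinj : Function.Injective (fderiv ℝ Φ (e x)) := by
    rw [hfd.fderiv, injective_iff_map_eq_zero]
    intro v hv
    have hcoord : ∀ k, v k + (fderiv ℝ (η ∘ e.symm) (e x) v - v j) *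
        (EuclideanSpace.single j (1 : ℝ) : EuclideanSpace ℝ (Fin d)) k = 0 := fun k =>
      congrArg (fun u : EuclideanSpace ℝ (Fin d) => u k) hv
    have hk : ∀ k, k ≠ j → v k = 0 := by
      intro k hkj
      have := hcoord k
      rwa [PiLp.single_apply, if_neg hkj, mul_zero, add_zero] at this
    have hvs : v = v j • EuclideanSpace.single j (1 : ℝ) := by
      ext k
      by_cases hkj : k = j
      · simp [hkj]
      · simp [hk k hkj, hkj]
    have h1 := hcoord j
    rw [PiLp.single_apply, if_pos rfl, mul_one, add_sub_cancel] at h1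
    rw [hvs, map_smul, smul_eq_mul] at h1
    rw [hvs, (mul_eq_zero.1 h1).resolve_right hj, zero_smul]
  obtain ⟨e', he', hxe', hsub, heq⟩ := exists_chart_eq_comp he hx hWopen hxW hΦ hinj
  refine ⟨e', he', hxe', fun y hy => ?_, fun y hy => ?_, fun k hk y => ?_⟩
  · obtain ⟨h1, h2⟩ := hsub hy
    have h3 : e.symm (e y) ∈ O := h2.2
    rw [e.left_inv h1] at h3
    exact ⟨h1, h3⟩
  · have h1 := (hsub hy).1
    rw [heq]
    simp [hΦdef, e.left_inv h1]
  · rw [heq]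
    simp [hΦdef, hk]

/-- A function with nonzero differential is a coordinate of some chart. -/
theorem exists_chart_coord_eq {x : M} {O : Set M} (hO : IsOpen O) (hxO : x ∈ O) {η : M → ℝ}
    (hη : ContMDiffOn (𝓡 d) 𝓘(ℝ, ℝ) ∞ η O)
    (h : (realDeriv η x : EuclideanSpace ℝ (Fin d) →L[ℝ] ℝ) ≠ 0) :
    ∃ e ∈ IsManifold.maximalAtlas (𝓡 d) ∞ M, ∃ i : Fin d, x ∈ e.source ∧ e.source ⊆ O ∧
      ∀ y ∈ e.source, e y i = η y := by
  have hc : chartAt (EuclideanSpace ℝ (Fin d)) x ∈ IsManifold.maximalAtlas (𝓡 d) ∞ M :=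
    IsManifold.chart_mem_maximalAtlas x
  have hx := mem_chart_source (EuclideanSpace ℝ (Fin d)) x
  set c := chartAt (EuclideanSpace ℝ (Fin d)) x
  have hj : ∃ j, fderiv ℝ (η ∘ c.symm) (c x) (EuclideanSpace.single j 1) ≠ 0 := by
    by_contra! hcon
    refine h (ContinuousLinearMap.ext fun v => ?_)
    rw [realDeriv_eq_fderiv hc hx (hη.contMDiffAt (hO.mem_nhds hxO)),
      ← (EuclideanSpace.basisFun (Fin d) ℝ).sum_repr (chartDeriv c x v), map_sum]
    refine Finset.sum_eq_zero fun i _ => ?_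
    rw [map_smul, EuclideanSpace.basisFun_apply, hcon, smul_zero]
  obtain ⟨j, hj⟩ := hj
  obtain ⟨e, he, hxe, hsub, h1, -⟩ := exists_chart_replace_coord hc hx hO hxO hη hj
  exact ⟨e, he, j, hxe, fun y hy => (hsub hy).2, h1⟩

/-- Two functions with linearly independent differentials are coordinates of some chart. -/
theorem exists_chart_two_coord_eq {x : M} {O : Set M} (hO : IsOpen O) (hxO : x ∈ O) {η η' : M → ℝ}
    (hη : ContMDiffOn (𝓡 d) 𝓘(ℝ, ℝ) ∞ η O) (hη' : ContMDiffOn (𝓡 d) 𝓘(ℝ, ℝ) ∞ η' O)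
    (h : (realDeriv η x : EuclideanSpace ℝ (Fin d) →L[ℝ] ℝ) ≠ 0)
    {v : EuclideanSpace ℝ (Fin d)} (hv : realDeriv η x v = 0) (hv' : realDeriv η' x v ≠ 0) :
    ∃ e ∈ IsManifold.maximalAtlas (𝓡 d) ∞ M, ∃ i j : Fin d, i ≠ j ∧ x ∈ e.source ∧ e.source ⊆ O ∧
      (∀ y ∈ e.source, e y i = η y) ∧ ∀ y ∈ e.source, e y j = η' y := by
  obtain ⟨e, he, i, hx, hsub, hi⟩ := exists_chart_coord_eq hO hxO hη h
  have hj : ∃ j, j ≠ i ∧ fderiv ℝ (η' ∘ e.symm) (e x) (EuclideanSpace.single j 1) ≠ 0 := by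
    by_contra! hcon
    refine hv' ?_
    rw [realDeriv_eq_fderiv he hx (hη'.contMDiffAt (hO.mem_nhds hxO)),
      ← (EuclideanSpace.basisFun (Fin d) ℝ).sum_repr (chartDeriv e x v), map_sum]
    refine Finset.sum_eq_zero fun j _ => ?_
    rw [map_smul, EuclideanSpace.basisFun_apply]
    by_cases hji : j = i
    · rw [realDeriv_of_coord_eq he hx (hη.contMDiffAt (hO.mem_nhds hxO)) hi] at hv
      rw [hji, EuclideanSpace.basisFun_repr, hv, zero_smul]
    · rw [hcon j hji, smul_zero]
  obtain ⟨j, hji, hj⟩ := hj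
  obtain ⟨e', he', hxe', hsub', h1, h2⟩ := exists_chart_replace_coord he hx hO hxO hη' hj
  exact ⟨e', he', i, j, hji.symm, hxe', fun y hy => (hsub' hy).2,
    fun y hy => by rw [h2 i hji.symm, hi y (hsub' hy).1], h1⟩

/-! ### Velocities of curves in level sets -/

/-- The velocity `v` is realized by the curve that is the line in direction `v` in a chart. -/
theorem isVelocityInto_of_chart (he : e ∈ IsManifold.maximalAtlas (𝓡 d) ∞ M) {x : M}
    (hx : x ∈ e.source) {S : Set M} {v : EuclideanSpace ℝ (Fin d)}
    (hS : ∀ s : ℝ, 0 ≤ s → ∀ y ∈ e.source, e y = e x + s • chartDeriv e x v → y ∈ S) :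
    IsVelocityInto (d := d) S x v := by
  have : IsManifold (𝓡 d) 1 M := IsManifold.of_le (n := ∞) (by norm_num)
  set l : ℝ → EuclideanSpace ℝ (Fin d) := fun s => e x + s • chartDeriv e x v with hl
  have hl0 : l 0 = e x := by simp [hl]
  have hlsmooth : ContDiff ℝ ∞ l := contDiff_const.add (contDiff_id.smul contDiff_const)
  have hlm : ContMDiff 𝓘(ℝ, ℝ) (𝓡 d) ∞ l := contMDiff_iff_contDiff.2 hlsmooth
  have hsymm : ContMDiffAt (𝓡 d) (𝓡 d) ∞ e.symm (l 0) := by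
    rw [hl0]
    exact contMDiffAt_symm_of_mem_maximalAtlas he (e.map_source hx)
  have hlt : ∀ᶠ s in 𝓝 (0 : ℝ), l s ∈ e.target := by
    refine hlsmooth.continuous.continuousAt.eventually (e.open_target.mem_nhds ?_)
    rw [hl0]; exact e.map_source hx
  refine ⟨e.symm ∘ l, ?_, hsymm.comp 0 hlm.contMDiffAt, ?_, ?_⟩
  · simp only [Function.comp_apply, hl0, e.left_inv hx]
  · filter_upwards [nhdsWithin_le_nhds hlt, self_mem_nhdsWithin] with s hs hs0
    exact hS s hs0 _ (e.map_target hs) (e.right_inv hs)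
  · have h1 : mfderiv 𝓘(ℝ, ℝ) (𝓡 d) (e.symm ∘ l) 0 =
        (mfderiv (𝓡 d) (𝓡 d) e.symm (l 0)).comp (mfderiv 𝓘(ℝ, ℝ) (𝓡 d) l 0) :=
      mfderiv_comp 0 (hsymm.mdifferentiableAt (by simp)) (hlm.mdifferentiableAt (by simp))
    have h2 : HasFDerivAt l ((1 : ℝ →L[ℝ] ℝ).smulRight (chartDeriv e x v)) 0 := by
      have := ((hasFDerivAt_id (𝕜 := ℝ) (0 : ℝ)).smul_const (chartDeriv e x v)).const_add (e x)
      exact this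
    have h3 : mfderiv 𝓘(ℝ, ℝ) (𝓡 d) l 0 = (1 : ℝ →L[ℝ] ℝ).smulRight (chartDeriv e x v) :=
      mfderiv_eq_fderiv.trans h2.fderiv
    have h4 : (mfderiv 𝓘(ℝ, ℝ) (𝓡 d) l 0 (1 : ℝ) : EuclideanSpace ℝ (Fin d)) =
        chartDeriv e x v := by
      rw [h3]
      change (1 : ℝ) • chartDeriv e x v = _
      rw [one_smul]
    rw [h1]
    have h5 := (mdifferentiable_of_mem_maximalAtlas he).symm_comp_deriv hx
    rw [← hl0] at h5
    have h6 : (mfderiv (𝓡 d) (𝓡 d) e.symm (l 0) (chartDeriv e x v) : EuclideanSpace ℝ (Fin d)) = v :=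
      congrArg (fun L : EuclideanSpace ℝ (Fin d) →L[ℝ] EuclideanSpace ℝ (Fin d) => L v) h5
    exact (congrArg (fun u : EuclideanSpace ℝ (Fin d) =>
      (mfderiv (𝓡 d) (𝓡 d) e.symm (l 0) u : EuclideanSpace ℝ (Fin d))) h4).trans h6

/-- The tangent space of a regular level set is the kernel of the differential. -/
theorem mem_tangentTo_iff {S : Set M} {x : M} {η : M → ℝ} {O : Set M} (hO : IsOpen O) (hxO : x ∈ O)
    (hη : ContMDiffOn (𝓡 d) 𝓘(ℝ, ℝ) ∞ η O) (hS : ∀ y ∈ O, y ∈ S ↔ η y = 0) (hxS : x ∈ S)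
    (h : (realDeriv η x : EuclideanSpace ℝ (Fin d) →L[ℝ] ℝ) ≠ 0)
    (v : EuclideanSpace ℝ (Fin d)) : v ∈ tangentTo (d := d) S x ↔ realDeriv η x v = 0 := by
  have hηx : η x = 0 := (hS x hxO).1 hxS
  have hat : ContMDiffAt (𝓡 d) 𝓘(ℝ, ℝ) ∞ η x := hη.contMDiffAt (hO.mem_nhds hxO)
  refine ⟨fun hv => realDeriv_eq_zero_of_mem_tangentTo hat hηx ?_ hv, fun hv => ?_⟩
  · filter_upwards [hO.mem_nhds hxO] with y hy using (hS y hy).1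
  · obtain ⟨e, he, i, hx, hsub, hi⟩ := exists_chart_coord_eq hO hxO hη h
    refine Submodule.subset_span (isVelocityInto_of_chart he hx fun s _ y hy hys => ?_)
    rw [hS y (hsub hy), ← hi y hy, hys, PiLp.add_apply, PiLp.smul_apply, hi x hx, hηx,
      ← realDeriv_of_coord_eq he hx hat hi, hv, smul_zero, add_zero]

end AdaptedCharts

/-! ### Vector fields defined by a contact form -/

namespace OneForm

variable {d n : ℕ} {M : Type*} [TopologicalSpace M] [ChartedSpace (EuclideanSpace ℝ (Fin d)) M]
  [IsManifold (𝓡 d) ∞ M] {α : OneForm d M}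

/-- The vector `v` at `x` with `i_v dα + α(v) α = β`, for a contact form `α`. -/
def IsContact.sharp (h : α.IsContact n) (x : M) (β : EuclideanSpace ℝ (Fin d) →L[ℝ] ℝ) :
    EuclideanSpace ℝ (Fin d) :=
  (h.existsUnique x β.toLinearMap).choose

theorem IsContact.sharp_spec (h : α.IsContact n) (x : M) (β : EuclideanSpace ℝ (Fin d) →L[ℝ] ℝ)
    (w : EuclideanSpace ℝ (Fin d)) :
    α.extDBilin x (h.sharp x β) w + α.toLin x (h.sharp x β) * α.toLin x w = β w :=
  (h.existsUnique x β.toLinearMap).choose_spec.1 w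

theorem IsContact.eq_sharp (h : α.IsContact n) {x : M} {β : EuclideanSpace ℝ (Fin d) →L[ℝ] ℝ}
    {v : EuclideanSpace ℝ (Fin d)}
    (hv : ∀ w, α.extDBilin x v w + α.toLin x v * α.toLin x w = β w) : v = h.sharp x β :=
  (h.existsUnique x β.toLinearMap).unique hv (h.sharp_spec x β)

variable {R : M → EuclideanSpace ℝ (Fin d)}

theorem IsReeb.extDBilin_left (hR : α.IsReeb R) (h : α.IsSmooth) (x : M)
    (w : EuclideanSpace ℝ (Fin d)) : α.extDBilin x (R x) w = 0 :=
  (h.extDBilin_apply x (R x) w).trans ((hR x).2 w)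

theorem IsReeb.extDBilin_right (hR : α.IsReeb R) (h : α.IsSmooth) (x : M)
    (w : EuclideanSpace ℝ (Fin d)) : α.extDBilin x w (R x) = 0 := by
  rw [extDBilin_antisymm, hR.extDBilin_left h, neg_zero]

/-- The contact form is annihilated by the solution of `i_v dα + α(v) α = β` if `β(R) = 0`. -/
theorem IsContact.toLin_sharp (h : α.IsContact n) (hR : α.IsReeb R) {x : M}
    {β : EuclideanSpace ℝ (Fin d) →L[ℝ] ℝ} (hβ : β (R x) = 0) : α.toLin x (h.sharp x β) = 0 := by
  have := h.sharp_spec x β (R x)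
  rwa [hR.extDBilin_right h.smooth, hR.toLin_apply, zero_add, mul_one, hβ] at this

theorem IsContact.extDBilin_sharp (h : α.IsContact n) (hR : α.IsReeb R) {x : M}
    {β : EuclideanSpace ℝ (Fin d) →L[ℝ] ℝ} (hβ : β (R x) = 0) (w : EuclideanSpace ℝ (Fin d)) :
    α.extDBilin x (h.sharp x β) w = β w := by
  have := h.sharp_spec x β w
  rwa [h.toLin_sharp hR hβ, zero_mul, add_zero] at this

/-- `dα` is nondegenerate on a hyperplane transverse to the Reeb field. -/
theorem IsContact.eq_zero_of_transverse (h : α.IsContact n) (hR : α.IsReeb R) {x : M}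
    {f : EuclideanSpace ℝ (Fin d) →L[ℝ] ℝ} (hf : f (R x) ≠ 0) {v : EuclideanSpace ℝ (Fin d)}
    (hv : f v = 0) (hΩ : ∀ w, f w = 0 → α.extDBilin x v w = 0) : v = 0 := by
  have hΩ' : ∀ w, α.extDBilin x v w = 0 := by
    intro w
    -- projecting `w` along `R` to the hyperplane does not change `dα(v, w)`
    have h1 := hΩ (w - (f w / f (R x)) • R x) (by
      rw [map_sub, map_smul, smul_eq_mul, div_mul_cancel₀ _ hf, sub_self])
    rw [map_sub, map_smul, hR.extDBilin_right h.smooth, smul_zero, sub_zero] at h1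
    exact h1
  have h2 : v = h.sharp x (α.toLin x v • α.toCLM x) :=
    h.eq_sharp fun w => by rw [hΩ', zero_add]; rfl
  have h3 : (α.toLin x v • R x : EuclideanSpace ℝ (Fin d)) =
      h.sharp x (α.toLin x v • α.toCLM x) :=
    h.eq_sharp fun w => by
      rw [map_smul, map_smul, LinearMap.smul_apply, hR.extDBilin_left h.smooth, hR.toLin_apply,
        smul_zero, zero_add, smul_eq_mul, mul_one]
      rfl
  have h4 : v = α.toLin x v • R x := h2.trans h3.symm
  have h5 : f v = α.toLin x v * f (R x) := by
    conv_lhs => rw [h4]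
    rw [map_smul, smul_eq_mul]
  rw [hv] at h5
  rw [h4, (mul_eq_zero.1 h5.symm).resolve_right hf]
  exact zero_smul ℝ _

/-- The Liouville vector of `α` on the hyperplane `ker f`, where `r` is the Reeb vector at `x` and
`f r ≠ 0`. -/
def IsContact.liouville (h : α.IsContact n) (x : M) (r : EuclideanSpace ℝ (Fin d))
    (f : EuclideanSpace ℝ (Fin d) →L[ℝ] ℝ) : EuclideanSpace ℝ (Fin d) :=
  h.sharp x (α.toCLM x - (f r)⁻¹ • f)

theorem IsContact.liouville_spec (h : α.IsContact n) (hR : α.IsReeb R) {x : M}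
    {f : EuclideanSpace ℝ (Fin d) →L[ℝ] ℝ} (hf : f (R x) ≠ 0) :
    f (h.liouville x (R x) f) = 0 ∧
      ∀ w, f w = 0 → α.extDBilin x (h.liouville x (R x) f) w = α.toLin x w := by
  have hβ : (α.toCLM x - (f (R x))⁻¹ • f) (R x) = 0 := by
    change α.toLin x (R x) - (f (R x))⁻¹ * f (R x) = 0
    rw [hR.toLin_apply, inv_mul_cancel₀ hf, sub_self]
  have h1 : ∀ w, α.extDBilin x (h.liouville x (R x) f) w = α.toLin x w - (f (R x))⁻¹ * f w :=
    h.extDBilin_sharp hR hβ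
  refine ⟨?_, fun w hw => by rw [h1, hw, mul_zero, sub_zero]⟩
  have h2 := h1 (h.liouville x (R x) f)
  have h3 : α.toLin x (h.liouville x (R x) f) = 0 := h.toLin_sharp hR hβ
  rw [extDBilin_self, h3, zero_sub, eq_comm, neg_eq_zero] at h2
  exact (mul_eq_zero.1 h2).resolve_left (inv_ne_zero hf)

/-- The rescaling `dη(R) X` of the Liouville field `X` on the level sets of a function `η`, as the
solution of `i_Y dα + α(Y) α = dη(R) α - dη`. It makes sense also where `dη(R) = 0`. -/
def IsContact.rescaledLiouville (h : α.IsContact n) (R : M → EuclideanSpace ℝ (Fin d)) (η : M → ℝ)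
    (x : M) : EuclideanSpace ℝ (Fin d) :=
  h.sharp x (realDeriv η x (R x) • α.toCLM x - realDeriv η x)

/-- Where `dη` is a multiple of `f`, the rescaled field is a multiple of the Liouville vector of `α` on
`ker f`, because both sides solve the same equation. -/
theorem IsContact.rescaledLiouville_eq (h : α.IsContact n) {η : M → ℝ} {x : M}
    {f : EuclideanSpace ℝ (Fin d) →L[ℝ] ℝ} (hf : f (R x) ≠ 0) {c : ℝ} (hc : realDeriv η x = c • f) :
    h.rescaledLiouville R η x = realDeriv η x (R x) • h.liouville x (R x) f := by
  refine (h.eq_sharp fun w => ?_).symm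
  have h1 := h.sharp_spec x (α.toCLM x - (f (R x))⁻¹ • f) w
  have h2 : (α.toCLM x - (f (R x))⁻¹ • f) w = α.toLin x w - (f (R x))⁻¹ * f w := rfl
  have h3 : (realDeriv η x (R x) • α.toCLM x - realDeriv η x :
      EuclideanSpace ℝ (Fin d) →L[ℝ] ℝ) w =
    realDeriv η x (R x) * α.toLin x w - realDeriv η x w := rfl
  have h4 : realDeriv η x w = c * f w := by rw [hc]; rfl
  have h5 : realDeriv η x (R x) = c * f (R x) := by rw [hc]; rfl
  rw [h3, map_smul, map_smul, LinearMap.smul_apply, smul_eq_mul, smul_eq_mul, mul_assoc, ← mul_add]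
  unfold liouville
  rw [h1, h2, h4, h5]
  field_simp

/-- The function `dη(R)` and the rescaled Liouville field are smooth wherever `η` is. The Reeb field
`R` is smooth because it solves `i_R dα + α(R) α = α`. -/
theorem IsContact.contMDiffAt_rescaledLiouville (h : α.IsContact n) (hR : α.IsReeb R) {η : M → ℝ}
    {O : Set M} (hO : IsOpen O) (hη : ContMDiffOn (𝓡 d) 𝓘(ℝ, ℝ) ∞ η O) {x₀ : M} (hx₀ : x₀ ∈ O) :
    ContMDiffAt (𝓡 d) 𝓘(ℝ, ℝ) ∞ (fun x => realDeriv η x (R x)) x₀ ∧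
    ContMDiffAt (𝓡 d) (𝓡 d).tangent ∞
      (fun x => (⟨x, h.rescaledLiouville R η x⟩ : TangentBundle (𝓡 d) M)) x₀ := by
  have hc : chartAt (EuclideanSpace ℝ (Fin d)) x₀ ∈ IsManifold.maximalAtlas (𝓡 d) ∞ M :=
    IsManifold.chart_mem_maximalAtlas x₀
  have hxs := mem_chart_source (EuclideanSpace ℝ (Fin d)) x₀
  set c := chartAt (EuclideanSpace ℝ (Fin d)) x₀ with hcdef
  have hcα : ContDiffAt ℝ ∞ (α.coordForm x₀) (c x₀) := (h.smooth.contDiffOn_coordForm x₀).contDiffAt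
    (c.open_target.mem_nhds (c.map_source hxs))
  have hηc : ContDiffAt ℝ ∞ (η ∘ c.symm) (c x₀) := by
    rw [← contMDiffAt_iff_contDiffAt]
    refine ContMDiffAt.comp (I' := 𝓡 d) (c x₀) ?_
      (contMDiffAt_symm_of_mem_maximalAtlas hc (c.map_source hxs))
    rw [c.left_inv hxs]
    exact hη.contMDiffAt (hO.mem_nhds hx₀)
  have hdη : ContDiffAt ℝ ∞ (fderiv ℝ (η ∘ c.symm)) (c x₀) := hηc.fderiv_right (m := ∞) (by simp)
  obtain ⟨Z, hZ, hZR⟩ := h.eventually_coord_eq x₀ (Y := R) hcα (by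
    filter_upwards [c.open_source.mem_nhds hxs] with x hx w
    rw [hR.extDBilin_left h.smooth, hR.toLin_apply, zero_add, one_mul]
    exact (α.coordForm_mfderiv x₀ hx w).symm)
  set G : EuclideanSpace ℝ (Fin d) → ℝ := fun y => fderiv ℝ (η ∘ c.symm) y (Z y) with hG
  have hGs : ContDiffAt ℝ ∞ G (c x₀) := hdη.clm_apply hZ
  have hcoord : ∀ᶠ x in 𝓝 x₀, ∀ v, realDeriv η x v =
      fderiv ℝ (η ∘ c.symm) (c x) (chartDeriv c x v) := by
    filter_upwards [c.open_source.mem_nhds hxs, hO.mem_nhds hx₀] with x hx hxO v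
    exact realDeriv_eq_fderiv hc hx (hη.contMDiffAt (hO.mem_nhds hxO)) v
  have hu : ∀ᶠ x in 𝓝 x₀, realDeriv η x (R x) = G (c x) := by
    filter_upwards [hcoord, hZR] with x h1 h2
    rw [h1]
    exact congrArg (fderiv ℝ (η ∘ c.symm) (c x)) h2
  constructor
  · have h1 : ContMDiffAt (𝓡 d) 𝓘(ℝ, ℝ) ∞ (G ∘ c) x₀ :=
      ContMDiffAt.comp (I' := 𝓡 d) x₀ (contMDiffAt_iff_contDiffAt.2 hGs)
        (contMDiffAt_of_mem_maximalAtlas hc hxs)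
    exact h1.congr_of_eventuallyEq hu
  · obtain ⟨Z', hZ', hY⟩ := h.eventually_coord_eq x₀ (Y := h.rescaledLiouville R η)
      (b := fun y => G y • α.coordForm x₀ y - fderiv ℝ (η ∘ c.symm) y)
      ((hGs.smul hcα).sub hdη) (by
        filter_upwards [hcoord, hu, c.open_source.mem_nhds hxs] with x h1 h2 hx w
        refine (h.sharp_spec x _ w).trans ?_
        have h3 : α.coordForm x₀ (c x) (chartDeriv c x w) = α.toCLM x w :=
          α.coordForm_mfderiv x₀ hx w
        change realDeriv η x (R x) * α.toCLM x w - realDeriv η x w =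
          G (c x) * α.coordForm x₀ (c x) (chartDeriv c x w) -
            fderiv ℝ (η ∘ c.symm) (c x) (chartDeriv c x w)
        rw [h3, h2, h1])
    exact contMDiffAt_vectorField_of_coord hZ' hY

end OneForm

/-! ### The binding and the pages of an open book -/

section OpenBookGeometry

theorem Circle.conj_mul_eq_one (t : Circle) : starRingEnd ℂ (t : ℂ) * (t : ℂ) = 1 := by
  rw [← Complex.normSq_eq_conj_mul_self, Circle.normSq_coe, Complex.ofReal_one]

theorem Circle.conj_mul_eq_one_iff (t z : Circle) :
    starRingEnd ℂ (t : ℂ) * (z : ℂ) = 1 ↔ z = t := by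
  refine ⟨fun h => ?_, fun h => h ▸ Circle.conj_mul_eq_one t⟩
  have h1 : (t : ℂ) * starRingEnd ℂ (t : ℂ) = 1 := by rw [mul_comm, Circle.conj_mul_eq_one]
  ext
  calc (z : ℂ) = t * starRingEnd ℂ (t : ℂ) * z := by rw [h1, one_mul]
    _ = t * (starRingEnd ℂ (t : ℂ) * z) := mul_assoc _ _ _
    _ = t := by rw [h, mul_one]

theorem Circle.norm_conj_mul (t z : Circle) : ‖starRingEnd ℂ (t : ℂ) * (z : ℂ)‖ = 1 := by
  rw [norm_mul, RCLike.norm_conj, Circle.norm_coe, Circle.norm_coe, mul_one]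

theorem mem_halfSpace_of_fibre {M B : Type*} {ι : B → M} {π : M → Circle} {t : Circle} {x : M}
    (hx : x ∉ range ι ∧ π x = t) :
    x ∉ range ι ∧ 0 < (starRingEnd ℂ (t : ℂ) * (π x : ℂ)).re := by
  refine ⟨hx.1, ?_⟩
  rw [hx.2, Circle.conj_mul_eq_one, Complex.one_re]
  exact one_pos

variable {d k : ℕ} {M : Type*} [TopologicalSpace M] [ChartedSpace (EuclideanSpace ℝ (Fin d)) M]
  {B : Type*} [TopologicalSpace B] [ChartedSpace (EuclideanSpace ℝ (Fin k)) B]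

/-- The differential at `x` of a complex function on `M`, as a map on the model space. -/
def complexDeriv (F : M → ℂ) (x : M) : EuclideanSpace ℝ (Fin d) →L[ℝ] ℂ :=
  mfderiv (𝓡 d) 𝓘(ℝ, ℂ) F x

theorem realDeriv_clm_comp {F : M → ℂ} {x : M} (hF : MDifferentiableAt (𝓡 d) 𝓘(ℝ, ℂ) F x)
    (L : ℂ →L[ℝ] ℝ) (v : EuclideanSpace ℝ (Fin d)) :
    realDeriv (fun y => L (F y)) x v = L (complexDeriv F x v) := by
  have h1 : mfderiv (𝓡 d) 𝓘(ℝ, ℝ) (L ∘ F) x =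
      (mfderiv 𝓘(ℝ, ℂ) 𝓘(ℝ, ℝ) L (F x)).comp (mfderiv (𝓡 d) 𝓘(ℝ, ℂ) F x) :=
    mfderiv_comp x L.mdifferentiableAt hF
  have h2 : mfderiv 𝓘(ℝ, ℂ) 𝓘(ℝ, ℝ) L (F x) = L := by
    rw [mfderiv_eq_fderiv]; exact L.fderiv
  rw [h2] at h1
  exact congrArg (fun T : EuclideanSpace ℝ (Fin d) →L[ℝ] ℝ => T v) h1

/-- The function `Im (t̄ π)`, whose zero set near the fibre of `π` over `t` is that fibre. -/
def fibreFunction (π : M → Circle) (t : Circle) (x : M) : ℝ :=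
  (starRingEnd ℂ (t : ℂ) * (π x : ℂ)).im

/-- The disc coordinate of a trivialization of a neighbourhood of the binding, rotated such that
the page over `t` is mapped to the nonnegative real half-line. -/
def discCoord (φ : OpenPartialHomeomorph (B × ℂ) M) (t : Circle) (x : M) : ℂ :=
  starRingEnd ℂ (t : ℂ) * (φ.symm x).2

/-- The linear map `z ↦ Im (t̄ z)`. -/
def rotatedIm (t : Circle) : ℂ →L[ℝ] ℝ :=
  Complex.imCLM.comp ((ContinuousLinearMap.mul ℝ ℂ) (starRingEnd ℂ (t : ℂ)))

section Fibre

variable {ι : B → M} {π : M → Circle} {t : Circle}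

theorem IsOpenBook.contMDiffOn_coe (h : IsOpenBook d k ι π) :
    ContMDiffOn (𝓡 d) 𝓘(ℝ, ℂ) ∞ (fun x => (π x : ℂ)) (range ι)ᶜ := by
  have : Fact (Module.finrank ℝ ℂ = 1 + 1) := ⟨Complex.finrank_real_complex⟩
  have h1 : ContMDiff (𝓡 1) 𝓘(ℝ, ℂ) ∞ (fun z : Circle => (z : ℂ)) :=
    contMDiff_coe_sphere (E := ℂ) (n := 1)
  exact h1.comp_contMDiffOn h.smooth

theorem IsOpenBook.contMDiffOn_fibreFunction (h : IsOpenBook d k ι π) :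
    ContMDiffOn (𝓡 d) 𝓘(ℝ, ℝ) ∞ (fibreFunction π t) (range ι)ᶜ :=
  (rotatedIm t).contMDiff.comp_contMDiffOn h.contMDiffOn_coe

theorem IsOpenBook.page_diff_range (h : IsOpenBook d k ι π) :
    page ι π t \ range ι = {x | x ∉ range ι ∧ π x = t} := by
  refine Subset.antisymm (fun x hx => ⟨hx.2, ?_⟩) fun x hx => ⟨subset_closure hx, hx.1⟩
  have hc : ContinuousAt π x :=
    (h.smooth.contMDiffAt (h.isClosed_range.isOpen_compl.mem_nhds hx.2)).continuousAt
  have h1 : π x ∈ closure (π '' {x | x ∉ range ι ∧ π x = t}) := mem_closure_image hc hx.1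
  have h2 : closure (π '' {x | x ∉ range ι ∧ π x = t}) ⊆ {t} :=
    closure_minimal (by rintro _ ⟨y, hy, rfl⟩; exact hy.2) isClosed_singleton
  exact h2 h1

/-- A neighbourhood of the open page over `t` that does not meet the page over `-t`. -/
theorem IsOpenBook.isOpen_halfSpace (h : IsOpenBook d k ι π) (t : Circle) :
    IsOpen {x | x ∉ range ι ∧ 0 < (starRingEnd ℂ (t : ℂ) * (π x : ℂ)).re} := by
  have h1 : ContinuousOn (fun x => (starRingEnd ℂ (t : ℂ) * (π x : ℂ)).re) (range ι)ᶜ :=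
    Complex.continuous_re.comp_continuousOn
      (continuousOn_const.mul h.contMDiffOn_coe.continuousOn)
  exact h1.isOpen_inter_preimage h.isClosed_range.isOpen_compl isOpen_Ioi

theorem IsOpenBook.mem_page_diff_range_iff (h : IsOpenBook d k ι π) {x : M}
    (hx : x ∉ range ι ∧ 0 < (starRingEnd ℂ (t : ℂ) * (π x : ℂ)).re) :
    x ∈ page ι π t \ range ι ↔ fibreFunction π t x = 0 := by
  rw [h.page_diff_range]
  constructor
  · rintro ⟨-, hπ⟩
    rw [fibreFunction, hπ, Circle.conj_mul_eq_one, Complex.one_im]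
  · intro h0
    refine ⟨hx.1, (Circle.conj_mul_eq_one_iff t _).1 ?_⟩
    have h1 := Complex.abs_re_eq_norm.2 h0
    rw [Circle.norm_conj_mul, abs_of_pos hx.2] at h1
    exact Complex.ext h1 h0

theorem IsOpenBook.realDeriv_fibreFunction (h : IsOpenBook d k ι π) {x : M}
    (hx : x ∉ range ι ∧ π x = t) (v : EuclideanSpace ℝ (Fin d)) :
    realDeriv (fibreFunction π t) x v = angularDeriv π x v := by
  have h1 : MDifferentiableAt (𝓡 d) 𝓘(ℝ, ℂ) (fun x => (π x : ℂ)) x :=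
    (h.contMDiffOn_coe.contMDiffAt (h.isClosed_range.isOpen_compl.mem_nhds hx.1)).mdifferentiableAt
      (by simp)
  have h2 := realDeriv_clm_comp h1 (rotatedIm t) v
  refine h2.trans ?_
  unfold angularDeriv
  rw [hx.2]
  rfl

end Fibre

variable (k) in
/-- The differential of the trivialization at a point of the binding. -/
def tubeDeriv (φ : OpenPartialHomeomorph (B × ℂ) M) (p : B) :
    EuclideanSpace ℝ (Fin k) × ℂ →L[ℝ] EuclideanSpace ℝ (Fin d) :=
  mfderiv ((𝓡 k).prod 𝓘(ℝ, ℂ)) (𝓡 d) φ (p, 0)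

/-- The differential of the embedding of the binding. -/
def bindingDeriv (ι : B → M) (p : B) :
    EuclideanSpace ℝ (Fin k) →L[ℝ] EuclideanSpace ℝ (Fin d) :=
  mfderiv (𝓡 k) (𝓡 d) ι p

namespace IsBindingTrivialization

variable {ι : B → M} {π : M → Circle} {δ : ℝ} {φ : OpenPartialHomeomorph (B × ℂ) M}

theorem mem_source (h : IsBindingTrivialization d k ι π δ φ) (p : B) : (p, (0 : ℂ)) ∈ φ.source := by
  rw [h.source_eq]
  exact ⟨mem_univ _, Metric.mem_ball_self h.pos⟩

theorem mem_target (h : IsBindingTrivialization d k ι π δ φ) (p : B) : ι p ∈ φ.target := by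
  rw [← h.zero_section]
  exact φ.map_source (h.mem_source p)

theorem range_subset (h : IsBindingTrivialization d k ι π δ φ) : range ι ⊆ φ.target := by
  rintro _ ⟨p, rfl⟩
  exact h.mem_target p

theorem contMDiffOn_discCoord (h : IsBindingTrivialization d k ι π δ φ) (t : Circle) :
    ContMDiffOn (𝓡 d) 𝓘(ℝ, ℂ) ∞ (discCoord φ t) φ.target :=
  ((ContinuousLinearMap.mul ℝ ℂ) (starRingEnd ℂ (t : ℂ))).contMDiff.comp_contMDiffOn
    (contMDiff_snd.comp_contMDiffOn h.smooth_symm)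

theorem contMDiffOn_discCoord_im (h : IsBindingTrivialization d k ι π δ φ) (t : Circle) :
    ContMDiffOn (𝓡 d) 𝓘(ℝ, ℝ) ∞ (fun x => (discCoord φ t x).im) φ.target :=
  Complex.imCLM.contMDiff.comp_contMDiffOn (h.contMDiffOn_discCoord t)

theorem contMDiffOn_discCoord_re (h : IsBindingTrivialization d k ι π δ φ) (t : Circle) :
    ContMDiffOn (𝓡 d) 𝓘(ℝ, ℝ) ∞ (fun x => (discCoord φ t x).re) φ.target :=
  Complex.reCLM.contMDiff.comp_contMDiffOn (h.contMDiffOn_discCoord t)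

theorem mem_range_iff (h : IsBindingTrivialization d k ι π δ φ) (t : Circle) {x : M}
    (hx : x ∈ φ.target) : x ∈ range ι ↔ discCoord φ t x = 0 := by
  have ht : starRingEnd ℂ (t : ℂ) ≠ 0 := left_ne_zero_of_mul_eq_one (Circle.conj_mul_eq_one t)
  constructor
  · rintro ⟨p, rfl⟩
    rw [discCoord, ← h.zero_section, φ.left_inv (h.mem_source p), mul_zero]
  · intro h0
    have h1 : (φ.symm x).2 = 0 := (mul_eq_zero.1 h0).resolve_left ht
    refine ⟨(φ.symm x).1, ?_⟩
    rw [← h.zero_section, ← h1, Prod.mk.eta, φ.right_inv hx]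

/-- Off the binding, `t̄ π` is the angular part of the rotated disc coordinate. -/
theorem discCoord_eq (h : IsBindingTrivialization d k ι π δ φ) (t : Circle) {x : M}
    (hx : x ∈ φ.target) (hxι : x ∉ range ι) :
    discCoord φ t x = ‖discCoord φ t x‖ * (starRingEnd ℂ (t : ℂ) * (π x : ℂ)) := by
  have h0 : (φ.symm x).2 ≠ 0 := by
    intro h0
    refine hxι ((h.mem_range_iff t hx).2 ?_)
    rw [discCoord, h0, mul_zero]
  have h1 : (φ.symm x).2 ∈ Metric.ball (0 : ℂ) δ := by
    have := φ.map_target hx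
    rw [h.source_eq] at this
    exact this.2
  have h2 := h.angular (φ.symm x).1 (φ.symm x).2 h1 h0
  rw [Prod.mk.eta, φ.right_inv hx] at h2
  have h3 : ‖discCoord φ t x‖ = ‖(φ.symm x).2‖ := by
    rw [discCoord, norm_mul, RCLike.norm_conj, Circle.norm_coe, one_mul]
  have h4 : ((‖(φ.symm x).2‖ : ℝ) : ℂ) ≠ 0 := by
    exact_mod_cast norm_ne_zero_iff.2 h0
  rw [h3, h2, discCoord]
  field_simp

/-- Near the binding, the open page is the part of the positive real axis in the disc coordinate. -/
theorem fibre_iff (h : IsBindingTrivialization d k ι π δ φ) (t : Circle) {x : M}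
    (hx : x ∈ φ.target) :
    (x ∉ range ι ∧ π x = t) ↔ (discCoord φ t x).im = 0 ∧ 0 < (discCoord φ t x).re := by
  constructor
  · rintro ⟨hxι, hπ⟩
    have h1 := h.discCoord_eq t hx hxι
    rw [hπ, Circle.conj_mul_eq_one, mul_one] at h1
    have h2 : 0 < ‖discCoord φ t x‖ :=
      norm_pos_iff.2 fun h0 => hxι ((h.mem_range_iff t hx).2 h0)
    rw [h1, Complex.ofReal_im, Complex.ofReal_re]
    exact ⟨rfl, h2⟩
  · rintro ⟨him, hre⟩
    have hxι : x ∉ range ι := by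
      intro hxι
      rw [(h.mem_range_iff t hx).1 hxι] at hre
      exact lt_irrefl _ hre
    refine ⟨hxι, (Circle.conj_mul_eq_one_iff t _).1 ?_⟩
    have h1 := h.discCoord_eq t hx hxι
    have h2 : ((‖discCoord φ t x‖ : ℝ) : ℂ) = discCoord φ t x := by
      rw [← Complex.abs_re_eq_norm.2 him, abs_of_pos hre]
      exact Complex.ext rfl him.symm
    rw [h2] at h1
    have h3 : discCoord φ t x ≠ 0 := fun h0 => hxι ((h.mem_range_iff t hx).2 h0)
    exact (mul_right_injective₀ h3 ((mul_one _).trans h1)).symm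

/-- Near the binding, the page is a half-plane. -/
theorem mem_page_iff (h : IsBindingTrivialization d k ι π δ φ) (t : Circle) {x : M}
    (hx : x ∈ φ.target) :
    x ∈ page ι π t ↔ (discCoord φ t x).im = 0 ∧ 0 ≤ (discCoord φ t x).re := by
  constructor
  · intro hxP
    have hc : ContinuousAt (discCoord φ t) x :=
      ((h.contMDiffOn_discCoord t).contMDiffAt (φ.open_target.mem_nhds hx)).continuousAt
    have h1 : x ∈ closure (φ.target ∩ {x | x ∉ range ι ∧ π x = t}) :=
      φ.open_target.inter_closure ⟨hx, hxP⟩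
    have h2 := mem_closure_image hc h1
    have hK : IsClosed {z : ℂ | z.im = 0 ∧ 0 ≤ z.re} :=
      (isClosed_eq Complex.continuous_im continuous_const).inter
        (isClosed_le continuous_const Complex.continuous_re)
    refine closure_minimal ?_ hK h2
    rintro _ ⟨y, ⟨hy, hyN⟩, rfl⟩
    have := (h.fibre_iff t hy).1 hyN
    exact ⟨this.1, this.2.le⟩
  · rintro ⟨him, hre⟩
    rcases hre.eq_or_lt with h0 | hpos
    · obtain ⟨p, rfl⟩ := (h.mem_range_iff t hx).2 (Complex.ext h0.symm him)
      -- the points `φ (p, s t)` with `s > 0` lie on the open page and tend to `ι p`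
      have hcont : ContinuousAt (fun s : ℝ => (p, (s : ℂ) * (t : ℂ))) 0 := by fun_prop
      have hz : (p, ((0 : ℝ) : ℂ) * (t : ℂ)) = (p, 0) := by simp
      have hsrc : ∀ᶠ s : ℝ in 𝓝 0, (p, (s : ℂ) * (t : ℂ)) ∈ φ.source := by
        refine hcont.eventually (φ.open_source.mem_nhds ?_)
        change (p, ((0 : ℝ) : ℂ) * (t : ℂ)) ∈ φ.source
        rw [hz]; exact h.mem_source p
      have htend : Tendsto (fun s : ℝ => φ (p, (s : ℂ) * (t : ℂ))) (𝓝[>] 0) (𝓝 (ι p)) := by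
        have h1 : ContinuousAt φ (p, ((0 : ℝ) : ℂ) * (t : ℂ)) := by
          rw [hz]; exact φ.continuousAt (h.mem_source p)
        have h2 : Tendsto (fun s : ℝ => φ (p, (s : ℂ) * (t : ℂ))) (𝓝 0)
            (𝓝 (φ (p, ((0 : ℝ) : ℂ) * (t : ℂ)))) :=
          Tendsto.comp h1 hcont
        rw [hz, h.zero_section] at h2
        exact h2.mono_left nhdsWithin_le_nhds
      refine mem_closure_of_tendsto htend ?_
      filter_upwards [nhdsWithin_le_nhds hsrc, self_mem_nhdsWithin] with s hs hs0
      refine (h.fibre_iff t (φ.map_source hs)).2 ?_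
      have h3 : discCoord φ t (φ (p, (s : ℂ) * (t : ℂ))) = (s : ℂ) := by
        rw [discCoord, φ.left_inv hs]
        change _ * ((s : ℂ) * (t : ℂ)) = _
        rw [mul_left_comm, Circle.conj_mul_eq_one, mul_one]
      rw [h3, Complex.ofReal_im, Complex.ofReal_re]
      exact ⟨rfl, hs0⟩
    · exact subset_closure ((h.fibre_iff t hx).2 ⟨him, hpos⟩)

/-- On the open page near the binding, the imaginary part of the disc coordinate and the function
that defines the fibre of `π` have proportional differentials. -/
theorem realDeriv_discCoord_im (h : IsBindingTrivialization d k ι π δ φ) (hb : IsOpenBook d k ι π)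
    {t : Circle} {x : M} (hx : x ∈ φ.target) (hxN : x ∉ range ι ∧ π x = t) :
    (realDeriv (fun y => (discCoord φ t y).im) x : EuclideanSpace ℝ (Fin d) →L[ℝ] ℝ) =
      ‖discCoord φ t x‖ • realDeriv (fibreFunction π t) x := by
  have h0 : discCoord φ t x ≠ 0 := fun h0 => hxN.1 ((h.mem_range_iff t hx).2 h0)
  have h1 : (fun y => (discCoord φ t y).im) =ᶠ[𝓝 x]
      (fun y => ‖discCoord φ t y‖) * fibreFunction π t := by
    filter_upwards [φ.open_target.mem_nhds hx, hb.isClosed_range.isOpen_compl.mem_nhds hxN.1]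
      with y hy hy'
    conv_lhs => rw [h.discCoord_eq t hy hy', Complex.im_ofReal_mul]
    rfl
  have hn : MDifferentiableAt (𝓡 d) 𝓘(ℝ, ℝ) (fun y => ‖discCoord φ t y‖) x := by
    have hn1 : MDifferentiableAt 𝓘(ℝ, ℂ) 𝓘(ℝ, ℝ) (fun z : ℂ => ‖z‖) (discCoord φ t x) :=
      ((contDiffAt_norm ℝ h0 (n := ∞)).differentiableAt (by simp)).mdifferentiableAt
    exact hn1.comp x (((h.contMDiffOn_discCoord t).contMDiffAt
      (φ.open_target.mem_nhds hx)).mdifferentiableAt (by simp))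
  have hf : MDifferentiableAt (𝓡 d) 𝓘(ℝ, ℝ) (fibreFunction π t) x :=
    (hb.contMDiffOn_fibreFunction.contMDiffAt
      (hb.isClosed_range.isOpen_compl.mem_nhds hxN.1)).mdifferentiableAt (by simp)
  have hf0 : fibreFunction π t x = 0 :=
    (hb.mem_page_diff_range_iff (mem_halfSpace_of_fibre hxN)).1 (hb.page_diff_range ▸ hxN)
  rw [realDeriv_congr h1]
  have h2 : (realDeriv ((fun y => ‖discCoord φ t y‖) * fibreFunction π t) x :
      EuclideanSpace ℝ (Fin d) →L[ℝ] ℝ) = ‖discCoord φ t x‖ • realDeriv (fibreFunction π t) x +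
        fibreFunction π t x • realDeriv (fun y => ‖discCoord φ t y‖) x :=
    (hn.hasMFDerivAt.mul hf.hasMFDerivAt).mfderiv
  rw [h2, hf0, zero_smul, add_zero]

theorem contMDiffAt_zero (h : IsBindingTrivialization d k ι π δ φ) (p : B) :
    ContMDiffAt ((𝓡 k).prod 𝓘(ℝ, ℂ)) (𝓡 d) ∞ φ (p, 0) :=
  h.smooth.contMDiffAt (φ.open_source.mem_nhds (h.mem_source p))

theorem eq_comp (h : IsBindingTrivialization d k ι π δ φ) : ι = φ ∘ fun p => (p, (0 : ℂ)) :=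
  funext fun p => (h.zero_section p).symm

theorem contMDiff_binding (h : IsBindingTrivialization d k ι π δ φ) :
    ContMDiff (𝓡 k) (𝓡 d) ∞ ι := by
  rw [h.eq_comp]
  intro p
  exact (h.contMDiffAt_zero p).comp p (contMDiffAt_id.prodMk contMDiffAt_const)

theorem tubeDeriv_apply_zero (h : IsBindingTrivialization d k ι π δ φ) (p : B)
    (b : EuclideanSpace ℝ (Fin k)) :
    (tubeDeriv k φ p (b, 0) : EuclideanSpace ℝ (Fin d)) = bindingDeriv ι p b := by
  have h1 : mfderiv (𝓡 k) (𝓡 d) (φ ∘ fun p => (p, (0 : ℂ))) p =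
      (mfderiv ((𝓡 k).prod 𝓘(ℝ, ℂ)) (𝓡 d) φ (p, 0)).comp
        (mfderiv (𝓡 k) ((𝓡 k).prod 𝓘(ℝ, ℂ)) (fun p => (p, (0 : ℂ))) p) :=
    mfderiv_comp p ((h.contMDiffAt_zero p).mdifferentiableAt (by simp))
      ((mdifferentiableAt_id).prodMk mdifferentiableAt_const)
  rw [mfderiv_prod_left, ← h.eq_comp] at h1
  exact (congrArg (fun T : EuclideanSpace ℝ (Fin k) →L[ℝ] EuclideanSpace ℝ (Fin d) => T b) h1).symm

theorem tubeDeriv_surjective (h : IsBindingTrivialization d k ι π δ φ) (p : B) :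
    Function.Surjective
      (tubeDeriv k φ p : EuclideanSpace ℝ (Fin k) × ℂ →L[ℝ] EuclideanSpace ℝ (Fin d)) := by
  have hs : ContMDiffAt (𝓡 d) ((𝓡 k).prod 𝓘(ℝ, ℂ)) ∞ φ.symm (φ (p, 0)) :=
    h.smooth_symm.contMDiffAt (φ.open_target.mem_nhds (φ.map_source (h.mem_source p)))
  have hφ : MDifferentiableAt ((𝓡 k).prod 𝓘(ℝ, ℂ)) (𝓡 d) φ (φ.symm (φ (p, 0))) := by
    rw [φ.left_inv (h.mem_source p)]
    exact (h.contMDiffAt_zero p).mdifferentiableAt (by simp)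
  have h1 := mfderiv_comp (φ (p, 0)) hφ (hs.mdifferentiableAt (by simp))
  have h2 : φ ∘ φ.symm =ᶠ[𝓝 (φ (p, 0))] id := by
    filter_upwards [φ.open_target.mem_nhds (φ.map_source (h.mem_source p))] with y hy
    exact φ.right_inv hy
  rw [h2.mfderiv_eq, mfderiv_id, φ.left_inv (h.mem_source p)] at h1
  intro v
  exact ⟨mfderiv (𝓡 d) ((𝓡 k).prod 𝓘(ℝ, ℂ)) φ.symm (φ (p, 0)) v,
    (congrArg (fun T : EuclideanSpace ℝ (Fin d) →L[ℝ] EuclideanSpace ℝ (Fin d) => T v) h1).symm⟩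

theorem complexDeriv_discCoord_tubeDeriv (h : IsBindingTrivialization d k ι π δ φ) (t : Circle)
    (p : B) (b : EuclideanSpace ℝ (Fin k)) (z : ℂ) :
    complexDeriv (discCoord φ t) (ι p) (tubeDeriv k φ p (b, z) : EuclideanSpace ℝ (Fin d)) =
      starRingEnd ℂ (t : ℂ) * z := by
  have hd : MDifferentiableAt (𝓡 d) 𝓘(ℝ, ℂ) (discCoord φ t) (φ (p, 0)) :=
    ((h.contMDiffOn_discCoord t).contMDiffAt
      (φ.open_target.mem_nhds (φ.map_source (h.mem_source p)))).mdifferentiableAt (by simp)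
  have h1 := mfderiv_comp (p, (0 : ℂ)) hd ((h.contMDiffAt_zero p).mdifferentiableAt (by simp))
  set L : ℂ →L[ℝ] ℂ := (ContinuousLinearMap.mul ℝ ℂ) (starRingEnd ℂ (t : ℂ)) with hL
  have h2 : discCoord φ t ∘ φ =ᶠ[𝓝 (p, (0 : ℂ))] L ∘ Prod.snd := by
    filter_upwards [φ.open_source.mem_nhds (h.mem_source p)] with y hy
    rw [Function.comp_apply, discCoord, φ.left_inv hy]
    rfl
  have h3 : mfderiv ((𝓡 k).prod 𝓘(ℝ, ℂ)) 𝓘(ℝ, ℂ) (L ∘ Prod.snd) (p, (0 : ℂ)) =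
      (mfderiv 𝓘(ℝ, ℂ) 𝓘(ℝ, ℂ) L 0).comp
        (mfderiv ((𝓡 k).prod 𝓘(ℝ, ℂ)) 𝓘(ℝ, ℂ) Prod.snd (p, (0 : ℂ))) :=
    mfderiv_comp (p, (0 : ℂ)) L.mdifferentiableAt mdifferentiableAt_snd
  have h4 : mfderiv 𝓘(ℝ, ℂ) 𝓘(ℝ, ℂ) L 0 = L := by
    rw [mfderiv_eq_fderiv]; exact L.fderiv
  rw [h4, mfderiv_snd, ← h2.mfderiv_eq, h1] at h3
  rw [← h.zero_section]
  exact congrArg (fun T : EuclideanSpace ℝ (Fin k) × ℂ →L[ℝ] ℂ => T (b, z)) h3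

/-- The tangent space of the binding is the kernel of the differential of the disc coordinate. -/
theorem complexDeriv_discCoord_eq_zero_iff (h : IsBindingTrivialization d k ι π δ φ) (t : Circle)
    (p : B) (v : EuclideanSpace ℝ (Fin d)) :
    complexDeriv (discCoord φ t) (ι p) v = 0 ↔
      ∃ b : EuclideanSpace ℝ (Fin k), bindingDeriv ι p b = v := by
  have ht : starRingEnd ℂ (t : ℂ) ≠ 0 := left_ne_zero_of_mul_eq_one (Circle.conj_mul_eq_one t)
  constructor
  · obtain ⟨⟨b, z⟩, rfl⟩ := h.tubeDeriv_surjective p v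
    intro h0
    rw [h.complexDeriv_discCoord_tubeDeriv] at h0
    rw [(mul_eq_zero.1 h0).resolve_left ht]
    exact ⟨b, (h.tubeDeriv_apply_zero p b).symm⟩
  · rintro ⟨b, rfl⟩
    rw [← h.tubeDeriv_apply_zero, h.complexDeriv_discCoord_tubeDeriv, mul_zero]

theorem realDeriv_discCoord_im_apply (h : IsBindingTrivialization d k ι π δ φ) (t : Circle) {x : M}
    (hx : x ∈ φ.target) (v : EuclideanSpace ℝ (Fin d)) :
    realDeriv (fun y => (discCoord φ t y).im) x v = (complexDeriv (discCoord φ t) x v).im :=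
  realDeriv_clm_comp (((h.contMDiffOn_discCoord t).contMDiffAt
    (φ.open_target.mem_nhds hx)).mdifferentiableAt (by simp)) Complex.imCLM v

theorem realDeriv_discCoord_re_apply (h : IsBindingTrivialization d k ι π δ φ) (t : Circle) {x : M}
    (hx : x ∈ φ.target) (v : EuclideanSpace ℝ (Fin d)) :
    realDeriv (fun y => (discCoord φ t y).re) x v = (complexDeriv (discCoord φ t) x v).re :=
  realDeriv_clm_comp (((h.contMDiffOn_discCoord t).contMDiffAt
    (φ.open_target.mem_nhds hx)).mdifferentiableAt (by simp)) Complex.reCLM v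

end IsBindingTrivialization

end OpenBookGeometry

/-! ### Pages as hypersurfaces with boundary -/

section PageGeometry

variable {d k : ℕ} {M : Type*} [TopologicalSpace M] [ChartedSpace (EuclideanSpace ℝ (Fin d)) M]
  [IsManifold (𝓡 d) ∞ M]
  {B : Type*} [TopologicalSpace B] [ChartedSpace (EuclideanSpace ℝ (Fin k)) B]
  {ι : B → M} {π : M → Circle} {δ : ℝ} {φ : OpenPartialHomeomorph (B × ℂ) M}

/-- The imaginary and real part of the rotated disc coordinate are coordinates of a chart. -/
theorem IsBindingTrivialization.exists_chart (h : IsBindingTrivialization d k ι π δ φ) (t : Circle)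
    (p : B) : ∃ e ∈ IsManifold.maximalAtlas (𝓡 d) ∞ M, ∃ i j : Fin d, i ≠ j ∧ ι p ∈ e.source ∧
      e.source ⊆ φ.target ∧ (∀ y ∈ e.source, e y i = (discCoord φ t y).im) ∧
      ∀ y ∈ e.source, e y j = (discCoord φ t y).re := by
  have hx := h.mem_target p
  refine exists_chart_two_coord_eq φ.open_target hx (h.contMDiffOn_discCoord_im t)
    (h.contMDiffOn_discCoord_re t) (fun h0 => ?_) (v := tubeDeriv k φ p (0, (t : ℂ))) ?_ ?_
  · have h1 := h.realDeriv_discCoord_im_apply t hx (tubeDeriv k φ p (0, t * Complex.I))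
    rw [h0, h.complexDeriv_discCoord_tubeDeriv, ← mul_assoc, Circle.conj_mul_eq_one, one_mul,
      Complex.I_im] at h1
    exact zero_ne_one h1
  · rw [h.realDeriv_discCoord_im_apply t hx, h.complexDeriv_discCoord_tubeDeriv,
      Circle.conj_mul_eq_one, Complex.one_im]
  · rw [h.realDeriv_discCoord_re_apply t hx, h.complexDeriv_discCoord_tubeDeriv,
      Circle.conj_mul_eq_one, Complex.one_re]
    exact one_ne_zero

theorem IsOpenBook.isHypersurfaceWithBoundary_page (hb : IsOpenBook d k ι π) {t : Circle}
    (hd : ∀ x, x ∉ range ι ∧ π x = t →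
      (realDeriv (fibreFunction π t) x : EuclideanSpace ℝ (Fin d) →L[ℝ] ℝ) ≠ 0) :
    IsHypersurfaceWithBoundary d (page ι π t) (range ι) where
  interior_chart x hx := by
    have hxN : x ∉ range ι ∧ π x = t := by rw [hb.page_diff_range] at hx; exact hx
    obtain ⟨e, he, i, hxe, hsub, hi⟩ := exists_chart_coord_eq (hb.isOpen_halfSpace t)
      (mem_halfSpace_of_fibre hxN)
      (hb.contMDiffOn_fibreFunction.mono fun y hy => hy.1) (hd x hxN)
    refine ⟨e, he, i, hxe, fun y hy => ?_⟩
    rw [hi y hy, ← hb.mem_page_diff_range_iff (hsub hy)]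
    exact ⟨fun hyP => ⟨hyP, (hsub hy).1⟩, fun hyP => hyP.1⟩
  boundary_chart := by
    rintro _ ⟨p, rfl⟩
    obtain ⟨δ, φ, h⟩ := hb.trivialization
    obtain ⟨e, he, i, j, hij, hxe, hsub, hi, hj⟩ := h.exists_chart t p
    refine ⟨e, he, i, j, hij, hxe, fun y hy => ?_, fun y hy => ?_⟩
    · rw [hi y hy, hj y hy, h.mem_page_iff t (hsub hy)]
    · rw [hi y hy, hj y hy, h.mem_range_iff t (hsub hy), Complex.ext_iff, and_comm]
      rfl

/-- A vector at a point of the binding points out of the page if its component in the disc points in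
the direction opposite to the page. -/
theorem IsBindingTrivialization.isOutward (h : IsBindingTrivialization d k ι π δ φ) {t : Circle}
    {p : B} {v : EuclideanSpace ℝ (Fin d)} (him : (complexDeriv (discCoord φ t) (ι p) v).im = 0)
    (hre : (complexDeriv (discCoord φ t) (ι p) v).re < 0) :
    IsOutward (d := d) (page ι π t) (range ι) (ι p) v := by
  have hx := h.mem_target p
  have hζ : discCoord φ t (ι p) = 0 := (h.mem_range_iff t hx).1 ⟨p, rfl⟩
  rw [← h.realDeriv_discCoord_im_apply t hx] at him
  rw [← h.realDeriv_discCoord_re_apply t hx] at hre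
  have hIm := (h.contMDiffOn_discCoord_im t).contMDiffAt (φ.open_target.mem_nhds hx)
  have hRe := (h.contMDiffOn_discCoord_re t).contMDiffAt (φ.open_target.mem_nhds hx)
  constructor
  · intro hv
    refine hre.ne (realDeriv_eq_zero_of_mem_tangentTo hRe (by rw [hζ, Complex.zero_re]) ?_ hv)
    filter_upwards [φ.open_target.mem_nhds hx] with y hy hyι
    rw [(h.mem_range_iff t hy).1 hyι, Complex.zero_re]
  · obtain ⟨e, he, i, j, -, hxe, hsub, hi, hj⟩ := h.exists_chart t p
    refine isVelocityInto_of_chart (v := -v) he hxe fun s hs y hy hys => ?_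
    rw [h.mem_page_iff t (hsub hy), ← hi y hy, ← hj y hy, hys]
    simp only [PiLp.add_apply, PiLp.smul_apply, smul_eq_mul]
    rw [hi _ hxe, hj _ hxe, hζ, ← realDeriv_of_coord_eq he hxe hIm hi,
      ← realDeriv_of_coord_eq he hxe hRe hj, map_neg, map_neg, him, Complex.zero_im,
      Complex.zero_re, neg_zero, mul_zero, zero_add, zero_add]
    exact ⟨rfl, mul_nonneg hs (neg_nonneg.2 hre.le)⟩

end PageGeometry

/-! ### The Liouville field along the binding -/

section Binding

variable {d k m : ℕ} {M : Type*} [TopologicalSpace M] [ChartedSpace (EuclideanSpace ℝ (Fin d)) M]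
  [IsManifold (𝓡 d) ∞ M]
  {B : Type*} [TopologicalSpace B] [ChartedSpace (EuclideanSpace ℝ (Fin k)) B]
  [IsManifold (𝓡 k) ∞ B]
  {ι : B → M} {π : M → Circle} {δ : ℝ} {φ : OpenPartialHomeomorph (B × ℂ) M}
  {α : OneForm d M} {R : M → EuclideanSpace ℝ (Fin d)}

theorem OneForm.IsContact.wedgePow_pullback (hα : α.IsSmooth)
    (hαB : (α.pullback ι : OneForm k B).IsContact m) (hι : ContMDiff (𝓡 k) (𝓡 d) ∞ ι) (p : B)
    (v : Fin (2 * m + 1) → EuclideanSpace ℝ (Fin k)) :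
    (α.pullback ι : OneForm k B).wedgePow m p v = (1 / 2 ^ m) *
      wedgeSum m (fun w => α.toLin (ι p) (bindingDeriv ι p w))
        (fun w w' => α.extDBilin (ι p) (bindingDeriv ι p w) (bindingDeriv ι p w')) v := by
  have h1 : (fun w w' => (α.pullback ι : OneForm k B).extDBilin p w w') =
      fun w w' : EuclideanSpace ℝ (Fin k) =>
        α.extDBilin (ι p) (bindingDeriv ι p w) (bindingDeriv ι p w') := by
    funext w w'
    rw [hαB.smooth.extDBilin_apply, hα.extDBilin_apply]
    exact hα.extD_pullback_apply hι.contMDiffAt w w'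
  rw [hαB.smooth.wedgePow_eq, h1]
  rfl

/-- Along the binding, the rescaled Liouville field has a disc component that points in the
direction opposite to the page. -/
theorem OneForm.IsContact.rescaledLiouville_binding (hα : α.IsContact (m + 1)) (hR : α.IsReeb R)
    (h : IsBindingTrivialization d k ι π δ φ) (hαB : (α.pullback ι : OneForm k B).IsContact m)
    {p : B} (hpos : ∀ v : Fin (2 * m + 1) → TangentSpace (𝓡 k) p,
      0 < (α.pullback ι : OneForm k B).wedgePow m p v →
      0 < α.wedgePow (m + 1) (ι p)
        (Matrix.vecCons
            (mfderiv ((𝓡 k).prod 𝓘(ℝ, ℂ)) (𝓡 d) φ (p, 0)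
              ((0, 1) : TangentSpace (𝓡 k) p × ℂ))
          (Matrix.vecCons
            (mfderiv ((𝓡 k).prod 𝓘(ℝ, ℂ)) (𝓡 d) φ (p, 0)
              ((0, Complex.I) : TangentSpace (𝓡 k) p × ℂ))
            (fun i => mfderiv (𝓡 k) (𝓡 d) ι p (v i)))))
    (hRp : ∃ r : EuclideanSpace ℝ (Fin k), bindingDeriv ι p r = R (ι p)) (t : Circle) :
    (complexDeriv (discCoord φ t) (ι p)
      (hα.rescaledLiouville R (fun y => (discCoord φ t y).im) (ι p))).im = 0 ∧
    (complexDeriv (discCoord φ t) (ι p)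
      (hα.rescaledLiouville R (fun y => (discCoord φ t y).im) (ι p))).re < 0 := by
  obtain ⟨r, hr⟩ := hRp
  have hx := h.mem_target p
  obtain ⟨v₀, hv₀⟩ : ∃ v : Fin (2 * m + 1) → EuclideanSpace ℝ (Fin k),
    (α.pullback ι : OneForm k B).wedgePow m p v ≠ 0 := hαB.ne_zero p
  have hw := fun v => hαB.wedgePow_pullback hα.smooth h.contMDiff_binding p v
  rw [hw] at hv₀
  have h2 : ∀ n : ℕ, (0 : ℝ) < 1 / 2 ^ n := fun n => by positivity
  refine disc_component_of_contact_pair (W := EuclideanSpace ℝ (Fin k)) (n := m)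
    (by rw [finrank_euclideanSpace_fin, hαB.dim_eq]) (a := α.toLin (ι p))
    (α.extDBilin_antisymm (ι p)) (bindingDeriv ι p).toLinearMap (v₀ := v₀)
    (right_ne_zero_of_mul hv₀) (R := r) ?_ ?_ (tubeDeriv k φ p (0, 1)) (tubeDeriv k φ p (0, Complex.I))
    ?_ (complexDeriv (discCoord φ t) (ι p)).toLinearMap ?_ (c := (t : ℂ)) (Circle.norm_coe t)
    ?_ ?_ ?_
  · exact (congrArg (α.toLin (ι p)) hr).trans (hR.toLin_apply (ι p))
  · intro v
    change α.extDBilin (ι p) (bindingDeriv ι p r) v = 0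
    rw [hr, hR.extDBilin_left hα.smooth]
  · intro v hv
    have h3 := hpos v (by
      have h4 := hw v
      exact lt_of_lt_of_eq (mul_pos (h2 m) hv) h4.symm)
    have h5 := hα.smooth.wedgePow_eq (m + 1) (ι p) (Matrix.vecCons (tubeDeriv k φ p (0, 1))
      (Matrix.vecCons (tubeDeriv k φ p (0, Complex.I)) (fun i => bindingDeriv ι p (v i))))
    have h6 := lt_of_lt_of_eq h3 h5
    exact (mul_pos_iff_of_pos_left (h2 _)).1 h6
  · exact h.complexDeriv_discCoord_eq_zero_iff t p
  · exact (h.complexDeriv_discCoord_tubeDeriv t p 0 1).trans (mul_one _)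
  · exact h.complexDeriv_discCoord_tubeDeriv t p 0 Complex.I
  · intro w
    have h3 : realDeriv (fun y => (discCoord φ t y).im) (ι p) (R (ι p)) = 0 := by
      rw [h.realDeriv_discCoord_im_apply t hx,
        (h.complexDeriv_discCoord_eq_zero_iff t p _).2 ⟨r, hr⟩, Complex.zero_im]
    rw [contactBilin_apply]
    refine (hα.sharp_spec (ι p) _ w).trans ?_
    rw [h3, zero_smul, zero_sub]
    change -realDeriv (fun y => (discCoord φ t y).im) (ι p) w = _
    rw [h.realDeriv_discCoord_im_apply t hx]
    rfl

end Binding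

end

theorem mainTheorem10 {m : ℕ}
    {M : Type*} [TopologicalSpace M] [ChartedSpace (EuclideanSpace ℝ (Fin (2 * m + 3))) M]
    [IsManifold (𝓡 (2 * m + 3)) ∞ M] [CompactSpace M] [T2Space M]
    {B : Type*} [TopologicalSpace B] [ChartedSpace (EuclideanSpace ℝ (Fin (2 * m + 1))) B]
    [IsManifold (𝓡 (2 * m + 1)) ∞ B]
    (α : OneForm (2 * m + 3) M) (hα : α.IsContact (m + 1))
    (ι : B → M) (π : M → Circle) (hπ : IsOpenBook (2 * m + 3) (2 * m + 1) ι π) (hs : Supports (2 * m + 1) m α ι π)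
    (t : Circle) :
    HasConvexBoundary α (page ι π t) (range ι) := by
  obtain ⟨δ, φ, hφ, hor⟩ := hs.positive_binding
  obtain ⟨R, hR, hRpos, hRB⟩ : ∃ R : M → EuclideanSpace ℝ (Fin (2 * m + 3)), α.IsReeb R ∧
    (∀ x ∉ range ι, 0 < angularDeriv π x (R x)) ∧
    (∀ p : B, R (ι p) ∈ range (mfderiv (𝓡 (2 * m + 1)) (𝓡 (2 * m + 3)) ι p)) := hs.reeb
  have hfR : ∀ x, x ∉ range ι ∧ π x = t → 0 < realDeriv (fibreFunction π t) x (R x) := by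
    intro x hx
    rw [hπ.realDeriv_fibreFunction hx]
    exact hRpos x hx.1
  have hf0 : ∀ x, x ∉ range ι ∧ π x = t →
      (realDeriv (fibreFunction π t) x : EuclideanSpace ℝ (Fin (2 * m + 3)) →L[ℝ] ℝ) ≠ 0 := by
    intro x hx h0
    have := hfR x hx
    rw [h0] at this
    exact lt_irrefl _ this
  have htan : ∀ x, x ∉ range ι ∧ π x = t → ∀ v : EuclideanSpace ℝ (Fin (2 * m + 3)),
      v ∈ tangentTo (d := 2 * m + 3) (page ι π t \ range ι) x ↔
        realDeriv (fibreFunction π t) x v = 0 := fun x hx v =>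
    mem_tangentTo_iff (hπ.isOpen_halfSpace t) (mem_halfSpace_of_fibre hx)
      (hπ.contMDiffOn_fibreFunction.mono fun y hy => hy.1)
      (fun y hy => hπ.mem_page_diff_range_iff hy) (hπ.page_diff_range ▸ hx) (hf0 x hx) v
  have hN : ∀ x ∈ page ι π t \ range ι, x ∉ range ι ∧ π x = t := fun x hx => by
    rw [hπ.page_diff_range] at hx; exact hx
  refine ⟨hπ.isHypersurfaceWithBoundary_page hf0, fun x hx v hv hΩ => ?_,
    fun x => hα.liouville x (R x) (realDeriv (fibreFunction π t) x), fun x hx => ?_, ?_⟩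
  · have hxN := hN x hx
    refine hα.eq_zero_of_transverse hR (hfR x hxN).ne' ((htan x hxN v).1 hv) fun w hw => ?_
    exact (hα.smooth.extDBilin_apply x v w).trans (hΩ w ((htan x hxN w).2 hw))
  · have hxN := hN x hx
    obtain ⟨h1, h2⟩ := hα.liouville_spec hR (hfR x hxN).ne'
    refine ⟨(htan x hxN _).2 h1, fun w hw => ?_⟩
    exact (hα.smooth.extDBilin_apply x _ w).symm.trans (h2 w ((htan x hxN w).1 hw))
  · set η : M → ℝ := fun y => (discCoord φ t y).im with hη
    refine ⟨φ.target, fun x => realDeriv η x (R x), hα.rescaledLiouville R η, φ.open_target,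
      hφ.range_subset, fun x hx => ?_, fun x hx => ?_, fun x hx => ?_, ?_⟩
    · exact (hα.contMDiffAt_rescaledLiouville hR φ.open_target (hφ.contMDiffOn_discCoord_im t)
        hx).1.contMDiffWithinAt
    · exact (hα.contMDiffAt_rescaledLiouville hR φ.open_target (hφ.contMDiffOn_discCoord_im t)
        hx).2.contMDiffWithinAt
    · have hxN := hN x hx.1
      have hc := hφ.realDeriv_discCoord_im hπ hx.2 hxN
      refine ⟨?_, hα.rescaledLiouville_eq (hfR x hxN).ne' hc⟩
      have hn : 0 < ‖discCoord φ t x‖ :=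
        norm_pos_iff.2 fun h0 => hxN.1 ((hφ.mem_range_iff t hx.2).2 h0)
      change 0 < realDeriv η x (R x)
      rw [hη, hc]
      exact mul_pos hn (hfR x hxN)
    · rintro _ ⟨p, rfl⟩
      obtain ⟨him, hre⟩ := hα.rescaledLiouville_binding hR hφ hs.contact_binding (hor p) (hRB p) t
      exact hφ.isOutward him hre
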